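/- **Definitions.** A *complex $*$-category* is a category whose Hom-sets are complex vector spaces with bilinear composition, equipped with a contravariant conjugate-linear involution $x\mapsto x^*$ acting identically on objects. *$*$-functors* are complex linear on the spaces of morphisms. A *fundamental symmetry* of a $*$-category $\mathcal C$ is a covariant $*$-functor $\alpha:\mathcal C\to\mathcal C$ that is the identity on objects, satisfies $\alpha\circ\alpha=\mathrm{id}$, and is such that (i) for some choice of norms making every $\mathrm{Hom}_{\mathcal C}(A,B)$ a Banach space, $\|\alpha(x^*)\circ x\|=\|x\|^2$ for every morphism $x$; and (ii) for every morphism $x:A\to B$ the element $p=\alpha(x^*)\circ x$ of $\mathrm{Hom}_{\mathcal C}(A,A)$ is positive for the involution $y\mapsto\alpha(y^*)$, i.e. $\alpha(p^*)=p$ and the spectrum of $p$ is contained in $[0,\infty)$. A *Kreĭn C\*-category* is a $*$-category that admits a fundamental symmetry. A *Kreĭn space* is a complex vector space $K$ with a Hermitian sesquilinear form $\langle\cdot,\cdot\rangle$ that admits a decomposition $K=K_+\oplus K_-$ into orthogonal subspaces such that $K_+$ is a Hilbert space for $\langle\cdot,\cdot\rangle$ and $K_-$ is a Hilbert space for $-\langle\cdot,\cdot\rangle$.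 The associated operator $J:x_++x_-\mapsto x_+-x_-$ is called a fundamental symmetry of $K$. The Hilbert norms $\|x\|_J=\langle x,Jx\rangle^{1/2}$ given by the various $J$ all induce the same topology on $K$, called the strong topology. For a family $\mathfrak K=(K_i)_i$ of Kreĭn spaces, $\mathcal B(\mathfrak K)$ is the $*$-category whose objects are the members of the family, whose morphisms are the strongly continuous linear maps $T:K_i\to K_j$, and whose involution is the Kreĭn adjoint, $\langle Tx,y\rangle=\langle x,T^*y\rangle$. For a family $J=(J_i)_i$ of fundamental symmetries put $\alpha_J(T):=J_j\,T\,J_i$ for $T:K_i\to K_j$. A $*$-subcategory of $\mathcal B(\mathfrak K)$ is *closed* if each of its spaces of morphisms is closed for the operator norm (for any choice of fundamental symmetries). **Theorem.** Let $\alpha$ be a fundamental symmetry of a Kreĭn C\*-category $\mathcal C$. Then there exist a family $\mathfrak K=(K_A)_{A\in\mathrm{Ob}\,\mathcal C}$ of Kreĭn spaces, a fundamental symmetry $J_A$ of each $K_A$, and a faithful representation of $\mathcal C$, i.e. a faithful (unital) covariant $*$-functor $\pi:\mathcal C\to\mathcal B(\mathfrak K)$ with $A\mapsto K_A$ on objects,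 such that 1. $\pi$ is $\alpha$-covariant: $\pi(\alpha(x))=\alpha_J(\pi(x))$ for every morphism $x$ of $\mathcal C$; 2. $\pi$ is an isomorphism of $\mathcal C$ onto a closed $*$-subcategory $\mathcal S$ of $\mathcal B(\mathfrak K)$ which is a Kreĭn C\*-category, the restriction of $\alpha_J$ to $\mathcal S$ being one of its fundamental symmetries. -/

import Mathlib

open CategoryTheory

universe u v w

noncomputable section

namespace Krein

/-! ### Complex star-categories and Krein C*-categories -/

/-- A complex star-category: a category enriched in complex vector spaces, with a contravariant
conjugate-linear involution on morphisms that is the identity on objects. -/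
class StarCategory (C : Type u) [Category.{v} C] [Preadditive C] [Linear ℂ C] where
  /-- the involution `x ↦ x*` -/
  star : ∀ {X Y : C}, (X ⟶ Y) → (Y ⟶ X)
  star_star : ∀ {X Y : C} (x : X ⟶ Y), star (star x) = x
  star_add : ∀ {X Y : C} (x y : X ⟶ Y), star (x + y) = star x + star y
  star_smul : ∀ {X Y : C} (c : ℂ) (x : X ⟶ Y), star (c • x) = (starRingEnd ℂ c) • star x
  star_comp : ∀ {X Y Z : C} (x : X ⟶ Y) (y : Y ⟶ Z), star (x ≫ y) = star y ≫ star x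

open StarCategory (star)

/-- A (complex linear, unital) covariant star-functor. -/
structure IsStarFunctor {C : Type*} {D : Type*} [Category* C] [Preadditive C] [Linear ℂ C]
    [StarCategory C] [Category* D] [Preadditive D] [Linear ℂ D] [StarCategory D]
    (F : C ⥤ D) : Prop where
  map_add : ∀ {X Y : C} (x y : X ⟶ Y), F.map (x + y) = F.map x + F.map y
  map_smul : ∀ {X Y : C} (c : ℂ) (x : X ⟶ Y), F.map (c • x) = c • F.map x
  map_star : ∀ {X Y : C} (x : X ⟶ Y), F.map (star x) = star (F.map x)

/-- An isomorphism of star-categories: a star-functor that is bijective on objects and on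
morphisms. -/
structure IsStarIso {C : Type*} {D : Type*} [Category* C] [Preadditive C] [Linear ℂ C]
    [StarCategory C] [Category* D] [Preadditive D] [Linear ℂ D] [StarCategory D]
    (F : C ⥤ D) : Prop extends IsStarFunctor F where
  bijective_obj : Function.Bijective F.obj
  bijective_map : ∀ X Y : C, Function.Bijective (F.map : (X ⟶ Y) → (F.obj X ⟶ F.obj Y))

/-- A covariant star-functor `α : C → C` with `α ∘ α = id` which is the identity on objects. -/
structure Involution (C : Type u) [Category.{v} C] [Preadditive C] [Linear ℂ C]
    [StarCategory C] where
  map : ∀ {X Y : C}, (X ⟶ Y) →ₗ[ℂ] (X ⟶ Y)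
  map_id : ∀ X : C, map (𝟙 X) = 𝟙 X
  map_comp : ∀ {X Y Z : C} (x : X ⟶ Y) (y : Y ⟶ Z), map (x ≫ y) = map x ≫ map y
  map_star : ∀ {X Y : C} (x : X ⟶ Y), map (star x) = star (map x)
  map_map : ∀ {X Y : C} (x : X ⟶ Y), map (map x) = x

/-- A seminorm that is a norm for which the space is complete. -/
structure IsBanachNorm {V : Type*} [AddCommGroup V] [Module ℂ V] (N : Seminorm ℂ V) : Prop where
  eq_zero : ∀ x, N x = 0 → x = 0
  complete : ∀ s : ℕ → V,
    (∀ ε > 0, ∃ n₀, ∀ m ≥ n₀, ∀ n ≥ n₀, N (s m - s n) < ε) →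
      ∃ x, Filter.Tendsto (fun n => N (s n - x)) Filter.atTop (nhds 0)

namespace Involution

variable {C : Type u} [Category.{v} C] [Preadditive C] [Linear ℂ C] [StarCategory C]

/-- Positivity of `p` in the algebra `Hom(X, X)` with involution `x ↦ α(x*)`: `p` is Hermitian
and its spectrum is contained in `[0, ∞)`. -/
def IsPositive (α : Involution C) {X : C} (p : X ⟶ X) : Prop :=
  α.map (star p) = p ∧ ∀ μ ∈ spectrum ℂ (A := End X) p, 0 ≤ μ.re ∧ μ.im = 0

/-- `α` is a fundamental symmetry: for some family of Banach norms on the spaces of morphisms,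
`‖α(x*) x‖ = ‖x‖²`, and every `α(x*) x` is positive.
(`x ≫ y` is the composition `y ∘ x`.) -/
def IsFundamentalSymmetry (α : Involution C) : Prop :=
  (∃ N : ∀ X Y : C, Seminorm ℂ (X ⟶ Y),
    (∀ X Y, IsBanachNorm (N X Y)) ∧
    ∀ {X Y : C} (x : X ⟶ Y), N X X (x ≫ α.map (star x)) = N X Y x ^ 2) ∧
  ∀ {X Y : C} (x : X ⟶ Y), α.IsPositive (x ≫ α.map (star x))

end Involution

/-- A Krein C*-category is a star-category that admits a fundamental symmetry. -/
class IsKreinCStarCategory (C : Type u) [Category.{v} C] [Preadditive C] [Linear ℂ C]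
    [StarCategory C] : Prop where
  exists_fundamentalSymmetry : ∃ α : Involution C, α.IsFundamentalSymmetry

/-! ### Star-subcategories -/

/-- A star-subcategory (with all the objects of the ambient category). -/
structure StarSubcategory (D : Type u) [Category.{v} D] [Preadditive D] [Linear ℂ D]
    [StarCategory D] where
  hom : ∀ X Y : D, Submodule ℂ (X ⟶ Y)
  id_mem : ∀ X : D, 𝟙 X ∈ hom X X
  comp_mem : ∀ {X Y Z : D} {x : X ⟶ Y} {y : Y ⟶ Z},
    x ∈ hom X Y → y ∈ hom Y Z → x ≫ y ∈ hom X Z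
  star_mem : ∀ {X Y : D} {x : X ⟶ Y}, x ∈ hom X Y → star x ∈ hom Y X

namespace StarSubcategory

variable {D : Type u} [Category.{v} D] [Preadditive D] [Linear ℂ D] [StarCategory D]

/-- The objects of a star-subcategory, regarded as a category on its own. -/
@[ext] structure Obj (S : StarSubcategory D) : Type u where
  obj : D

variable (S : StarSubcategory D)

instance : Category.{v} S.Obj where
  Hom X Y := S.hom X.obj Y.obj
  id X := ⟨𝟙 X.obj, S.id_mem X.obj⟩
  comp x y := ⟨x.1 ≫ y.1, S.comp_mem x.2 y.2⟩
  id_comp x := Subtype.ext (Category.id_comp x.1)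
  comp_id x := Subtype.ext (Category.comp_id x.1)
  assoc x y z := Subtype.ext (Category.assoc x.1 y.1 z.1)

instance : Preadditive S.Obj where
  homGroup X Y := inferInstanceAs (AddCommGroup (S.hom X.obj Y.obj))
  add_comp _ _ _ x y z := Subtype.ext (Preadditive.add_comp _ _ _ x.1 y.1 z.1)
  comp_add _ _ _ x y z := Subtype.ext (Preadditive.comp_add _ _ _ x.1 y.1 z.1)

instance : Linear ℂ S.Obj where
  homModule X Y := inferInstanceAs (Module ℂ (S.hom X.obj Y.obj))
  smul_comp _ _ _ c x y := Subtype.ext (Linear.smul_comp _ _ _ c x.1 y.1)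
  comp_smul _ _ _ x c y := Subtype.ext (Linear.comp_smul _ _ _ x.1 c y.1)

instance : StarCategory S.Obj where
  star x := ⟨star x.1, S.star_mem x.2⟩
  star_star x := Subtype.ext (StarCategory.star_star x.1)
  star_add x y := Subtype.ext (StarCategory.star_add x.1 y.1)
  star_smul c x := Subtype.ext (StarCategory.star_smul c x.1)
  star_comp x y := Subtype.ext (StarCategory.star_comp x.1 y.1)

/-- The inclusion functor of a star-subcategory. -/
def incl : S.Obj ⥤ D where
  obj X := X.obj
  map x := x.1
  map_id _ := rfl
  map_comp _ _ := rfl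

end StarSubcategory

/-! ### Krein spaces -/

/-- A Hermitian form restricted to the subspace `S` makes `S` a Hilbert space: it is positive
definite on `S`, and `S` is complete for `‖x‖² = ⟨x, x⟩`. -/
structure IsHilbertOn {V : Type*} [AddCommGroup V] [Module ℂ V] (B : V →ₗ⋆[ℂ] V →ₗ[ℂ] ℂ)
    (S : Submodule ℂ V) : Prop where
  pos : ∀ x ∈ S, x ≠ 0 → 0 < (B x x).re
  complete : ∀ s : ℕ → V, (∀ n, s n ∈ S) →
    (∀ ε > 0, ∃ n₀, ∀ m ≥ n₀, ∀ n ≥ n₀, (B (s m - s n) (s m - s n)).re < ε) →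
      ∃ x ∈ S, Filter.Tendsto (fun n => (B (s n - x) (s n - x)).re) Filter.atTop (nhds 0)

/-- `V = P ⊕ M`, with `P` and `M` orthogonal, `P` a Hilbert space for the form `B` and
`M` a Hilbert space for `-B`. -/
structure IsFundamentalDecomposition {V : Type*} [AddCommGroup V] [Module ℂ V]
    (B : V →ₗ⋆[ℂ] V →ₗ[ℂ] ℂ) (P M : Submodule ℂ V) : Prop where
  isCompl : IsCompl P M
  orthogonal : ∀ x ∈ P, ∀ y ∈ M, B x y = 0
  hilbert_pos : IsHilbertOn B P
  hilbert_neg : IsHilbertOn (-B) M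

/-- A complex Krein space; the form is conjugate-linear in the first variable and linear in the
second. -/
structure KreinSpace : Type (w + 1) where
  carrier : Type w
  [addCommGroup : AddCommGroup carrier]
  [module : Module ℂ carrier]
  form : carrier →ₗ⋆[ℂ] carrier →ₗ[ℂ] ℂ
  form_symm : ∀ x y, starRingEnd ℂ (form x y) = form y x
  exists_decomposition : ∃ P M : Submodule ℂ carrier, IsFundamentalDecomposition form P M

namespace KreinSpace

instance : CoeSort KreinSpace.{w} (Type w) := ⟨carrier⟩

attribute [instance] addCommGroup module

/-- The fundamental symmetries `x₊ + x₋ ↦ x₊ - x₋` of a Krein space. -/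
structure FundamentalSymmetry (K : KreinSpace.{w}) where
  toLin : K →ₗ[ℂ] K
  exists_decomposition : ∃ P M : Submodule ℂ K, IsFundamentalDecomposition K.form P M ∧
    ∀ x ∈ P, ∀ y ∈ M, toLin (x + y) = x - y

variable (K : KreinSpace.{w})

instance : Nonempty K.FundamentalSymmetry := by
  obtain ⟨P, M, h⟩ := K.exists_decomposition
  refine ⟨⟨P.subtype ∘ₗ P.projectionOnto M h.isCompl - M.subtype ∘ₗ M.projectionOnto P h.isCompl.symm,
    P, M, h, fun x hx y hy => ?_⟩⟩
  have h1 : P.projectionOnto M h.isCompl x = ⟨x, hx⟩ :=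
    Submodule.projectionOnto_apply_left h.isCompl ⟨x, hx⟩
  have h2 := (Submodule.projectionOnto_apply_eq_zero_iff h.isCompl (x := y)).2 hy
  have h3 : M.projectionOnto P h.isCompl.symm y = ⟨y, hy⟩ :=
    Submodule.projectionOnto_apply_left h.isCompl.symm ⟨y, hy⟩
  have h4 := (Submodule.projectionOnto_apply_eq_zero_iff h.isCompl.symm (x := x)).2 hx
  change ((P.projectionOnto M h.isCompl (x + y) : P) : K) -
    ((M.projectionOnto P h.isCompl.symm (x + y) : M) : K) = x - y
  rw [map_add, map_add, h1, h2, h3, h4, add_zero, zero_add]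

variable {K}

namespace FundamentalSymmetry

variable (J : K.FundamentalSymmetry)

instance : CoeFun K.FundamentalSymmetry (fun _ => K → K) := ⟨fun J => J.toLin⟩

theorem exists_parts : ∃ P M : Submodule ℂ K, IsFundamentalDecomposition K.form P M ∧
    (∀ x ∈ P, J x = x) ∧ (∀ x ∈ M, J x = -x) ∧
    ∀ x : K, ∃ p ∈ P, ∃ m ∈ M, x = p + m := by
  obtain ⟨P, M, h, hJ⟩ := J.exists_decomposition
  refine ⟨P, M, h, fun x hx => by simpa using hJ x hx 0 M.zero_mem,
    fun x hx => by simpa using hJ 0 P.zero_mem x hx, fun x => ?_⟩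
  obtain ⟨p, hp, m, hm, rfl⟩ := Submodule.mem_sup.1
    (h.isCompl.sup_eq_top ▸ Submodule.mem_top : x ∈ P ⊔ M)
  exact ⟨p, hp, m, hm, rfl⟩

theorem apply_apply (x : K) : J (J x) = x := by
  obtain ⟨P, M, h, hP, hM, hx⟩ := J.exists_parts
  obtain ⟨p, hp, m, hm, rfl⟩ := hx x
  simp [map_add, hP p hp, hM m hm]

theorem form_apply_right {P M : Submodule ℂ K} (h : IsFundamentalDecomposition K.form P M)
    (hP : ∀ x ∈ P, J x = x) (hM : ∀ x ∈ M, J x = -x) {p q m n : K}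
    (hp : p ∈ P) (hq : q ∈ P) (hm : m ∈ M) (hn : n ∈ M) :
    K.form (p + m) (J (q + n)) = K.form p q - K.form m n := by
  have h2 : K.form m q = 0 := by
    rw [← K.form_symm, h.orthogonal q hq m hm, map_zero]
  simp [map_add, hP q hq, hM n hn, h.orthogonal p hp n hn, h2, sub_eq_add_neg]

theorem form_symm_apply (x y : K) : K.form (J x) y = K.form x (J y) := by
  obtain ⟨P, M, h, hP, hM, hx⟩ := J.exists_parts
  obtain ⟨p, hp, m, hm, rfl⟩ := hx x
  obtain ⟨q, hq, n, hn, rfl⟩ := hx y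
  have := J.form_apply_right h hP hM hp hq (M.neg_mem hm) (M.neg_mem hn)
  rw [J.form_apply_right h hP hM hp hq hm hn]
  have h2 : K.form m q = 0 := by
    rw [← K.form_symm, h.orthogonal q hq m hm, map_zero]
  simp [map_add, hP p hp, hM m hm, h.orthogonal p hp n hn, h2, sub_eq_add_neg]

theorem form_self (x : K) (P M : Submodule ℂ K) (h : IsFundamentalDecomposition K.form P M) :
    (x ∈ P → x ≠ 0 → 0 < (K.form x x).re) ∧ (x ∈ M → x ≠ 0 → (K.form x x).re < 0) :=
  ⟨h.hilbert_pos.pos x, fun hx hx0 => by simpa using h.hilbert_neg.pos x hx hx0⟩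

/-- The inner product `⟨x, J y⟩ = ⟨x₊, y₊⟩ - ⟨x₋, y₋⟩` of `|K|_J = K₊ ⊕ (-K₋)`. -/
@[reducible] def core : InnerProductSpace.Core ℂ K where
  inner x y := K.form x (J y)
  conj_inner_symm x y := by rw [K.form_symm, form_symm_apply]
  re_inner_nonneg x := by
    obtain ⟨P, M, h, hP, hM, hx⟩ := J.exists_parts
    obtain ⟨p, hp, m, hm, rfl⟩ := hx x
    rw [J.form_apply_right h hP hM hp hp hm hm]
    have h1 : 0 ≤ (K.form p p).re := by
      rcases eq_or_ne p 0 with rfl | h0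
      · simp
      · exact ((form_self p P M h).1 hp h0).le
    have h2 : (K.form m m).re ≤ 0 := by
      rcases eq_or_ne m 0 with rfl | h0
      · simp
      · exact ((form_self m P M h).2 hm h0).le
    simp only [RCLike.re_to_complex, Complex.sub_re]
    linarith
  add_left x y z := by simp
  smul_left x y r := by simp
  definite x hx := by
    obtain ⟨P, M, h, hP, hM, hx'⟩ := J.exists_parts
    obtain ⟨p, hp, m, hm, rfl⟩ := hx' x
    change K.form (p + m) (J (p + m)) = 0 at hx
    rw [J.form_apply_right h hP hM hp hp hm hm] at hx
    have hre := congrArg Complex.re hx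
    simp only [Complex.sub_re, Complex.zero_re] at hre
    by_cases hp0 : p = 0
    · subst hp0
      by_cases hm0 : m = 0
      · simp [hm0]
      · have := (form_self m P M h).2 hm hm0
        simp at hre; linarith
    · have h1 := (form_self p P M h).1 hp hp0
      by_cases hm0 : m = 0
      · subst hm0; simp at hre; linarith
      · have := (form_self m P M h).2 hm hm0
        linarith

/-- The Hilbert space `|K|_J` associated to a fundamental symmetry `J`. -/
@[nolint unusedArguments]
def Assoc (_J : K.FundamentalSymmetry) : Type w := K

instance : NormedAddCommGroup J.Assoc :=
  @InnerProductSpace.Core.toNormedAddCommGroup ℂ K _ _ _ J.core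

instance : InnerProductSpace ℂ J.Assoc :=
  @InnerProductSpace.ofCore ℂ K _ _ _ J.core.toCore

instance : Inner ℂ J.Assoc := InnerProductSpace.toInner

/-- The identity map `K → |K|_J`. -/
def toAssoc : K ≃ₗ[ℂ] J.Assoc := LinearEquiv.refl ℂ K

theorem inner_toAssoc (x y : K) : inner ℂ (J.toAssoc x) (J.toAssoc y) = K.form x (J y) := rfl

theorem norm_sq_toAssoc (x : K) : ‖J.toAssoc x‖ ^ 2 = (K.form x (J x)).re := by
  rw [norm_sq_eq_re_inner (𝕜 := ℂ), inner_toAssoc]; rfl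

instance : CompleteSpace J.Assoc := by
  obtain ⟨P, M, h, hP, hM, hx⟩ := J.exists_parts
  refine Metric.complete_of_cauchySeq_tendsto fun s hs => ?_
  choose p hp m hm hpm using fun n => hx (J.toAssoc.symm (s n))
  have key : ∀ p ∈ P, ∀ m ∈ M, ‖J.toAssoc (p + m)‖ ^ 2 =
      (K.form p p).re + ((-K.form) m m).re := fun p hp m hm => by
    rw [norm_sq_toAssoc, J.form_apply_right h hP hM hp hp hm hm]
    simp [sub_eq_add_neg]
  have nnP : ∀ p ∈ P, 0 ≤ (K.form p p).re := fun p hp => by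
    rcases eq_or_ne p 0 with rfl | h0
    · simp
    · exact (h.hilbert_pos.pos p hp h0).le
  have nnM : ∀ p ∈ M, 0 ≤ ((-K.form) p p).re := fun p hp => by
    rcases eq_or_ne p 0 with rfl | h0
    · simp
    · exact (h.hilbert_neg.pos p hp h0).le
  have hsn : ∀ n, s n = J.toAssoc (p n + m n) := fun n => by
    rw [← hpm n, LinearEquiv.apply_symm_apply]
  have hdiff : ∀ a b, ‖s a - s b‖ ^ 2 =
      (K.form (p a - p b) (p a - p b)).re + ((-K.form) (m a - m b) (m a - m b)).re :=
    fun a b => by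
      rw [← key _ (P.sub_mem (hp a) (hp b)) _ (M.sub_mem (hm a) (hm b)), hsn, hsn, ← map_sub]
      congr 3; abel
  have cau : ∀ ε > 0, ∃ n₀, ∀ a ≥ n₀, ∀ b ≥ n₀, ‖s a - s b‖ ^ 2 < ε := fun ε hε => by
    obtain ⟨n₀, h₀⟩ := Metric.cauchySeq_iff.1 hs (Real.sqrt ε) (Real.sqrt_pos.2 hε)
    refine ⟨n₀, fun a ha b hb => ?_⟩
    have := h₀ a ha b hb
    rw [dist_eq_norm] at this
    exact (Real.lt_sqrt (norm_nonneg _)).1 this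
  obtain ⟨x, hxP, hx1⟩ := h.hilbert_pos.complete p hp fun ε hε => by
    obtain ⟨n₀, h₀⟩ := cau ε hε
    refine ⟨n₀, fun a ha b hb => ?_⟩
    have := h₀ a ha b hb
    have := nnM _ (M.sub_mem (hm a) (hm b))
    linarith [hdiff a b]
  obtain ⟨y, hyM, hy1⟩ := h.hilbert_neg.complete m hm fun ε hε => by
    obtain ⟨n₀, h₀⟩ := cau ε hε
    refine ⟨n₀, fun a ha b hb => ?_⟩
    have := h₀ a ha b hb
    have := nnP _ (P.sub_mem (hp a) (hp b))
    linarith [hdiff a b]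
  refine ⟨J.toAssoc (x + y), ?_⟩
  rw [tendsto_iff_norm_sub_tendsto_zero]
  have h2 : Filter.Tendsto (fun n => ‖s n - J.toAssoc (x + y)‖ ^ 2) Filter.atTop (nhds 0) := by
    have := hx1.add hy1
    rw [add_zero] at this
    refine this.congr fun n => ?_
    rw [← key _ (P.sub_mem (hp n) hxP) _ (M.sub_mem (hm n) hyM), hsn, ← map_sub]
    congr 3; abel
  have h3 := h2.sqrt
  simpa only [Real.sqrt_sq (norm_nonneg _), Real.sqrt_zero] using h3

theorem continuous_form_left (z : K) :
    Continuous fun x : J.Assoc => K.form (J.toAssoc.symm x) z := by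
  have : (fun x : J.Assoc => K.form (J.toAssoc.symm x) z) =
      fun x => inner ℂ x (J.toAssoc (J z)) := by
    funext x
    obtain ⟨x, rfl⟩ := J.toAssoc.surjective x
    rw [inner_toAssoc, apply_apply, LinearEquiv.symm_apply_apply]
  rw [this]
  fun_prop

theorem eq_of_form_left {x y : K} (h : ∀ z, K.form x z = K.form y z) : x = y := by
  obtain ⟨J⟩ := (inferInstance : Nonempty K.FundamentalSymmetry)
  rw [← sub_eq_zero]
  apply J.core.definite
  change K.form (x - y) (J (x - y)) = 0
  simp [h]

/-- The identity map `|K|_J → |K|_J'` is continuous. -/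
theorem continuous_change (J J' : K.FundamentalSymmetry) :
    Continuous (J.toAssoc.symm ≪≫ₗ J'.toAssoc) := by
  refine LinearMap.continuous_of_seq_closed_graph
    (g := (J.toAssoc.symm ≪≫ₗ J'.toAssoc : J.Assoc →ₗ[ℂ] J'.Assoc)) fun s x y hs hy => ?_
  apply J'.toAssoc.symm.injective
  refine eq_of_form_left fun z => ?_
  have h1 := ((J.continuous_form_left z).tendsto x).comp hs
  have h2 := ((J'.continuous_form_left z).tendsto y).comp hy
  refine tendsto_nhds_unique h2 (h1.congr fun n => ?_) |>.trans ?_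
  · rfl
  · rfl

end FundamentalSymmetry

/-- The strong topology of a Krein space: the topology generated by the norms of the associated
Hilbert spaces `|K|_J`. All these norms induce this same topology, see `strongTopology_eq`. -/
instance strongTopology (K : KreinSpace.{w}) : TopologicalSpace K :=
  ⨅ J : K.FundamentalSymmetry, TopologicalSpace.induced J.toAssoc inferInstance

theorem strongTopology_eq (J : K.FundamentalSymmetry) :
    strongTopology K = TopologicalSpace.induced J.toAssoc inferInstance := by
  refine le_antisymm (iInf_le _ J) (le_iInf fun J' => ?_)
  have := FundamentalSymmetry.continuous_change J J'
  rw [continuous_iff_le_induced] at this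
  have := induced_mono (g := J.toAssoc) this
  rw [induced_compose] at this
  exact this

/-- The identity map as a homeomorphism from `K` onto `|K|_J`. -/
def FundamentalSymmetry.toAssocL (J : K.FundamentalSymmetry) : K ≃L[ℂ] J.Assoc where
  toLinearEquiv := J.toAssoc
  continuous_toFun := by
    rw [continuous_iff_le_induced, strongTopology_eq J]; exact le_rfl
  continuous_invFun := by
    rw [strongTopology_eq J, continuous_induced_rng]
    exact continuous_id

instance (K : KreinSpace.{w}) : IsTopologicalAddGroup K := by
  obtain ⟨J⟩ := (inferInstance : Nonempty K.FundamentalSymmetry)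
  rw [strongTopology_eq J]
  exact topologicalAddGroup_induced J.toAssoc

instance (K : KreinSpace.{w}) : ContinuousSMul ℂ K := by
  obtain ⟨J⟩ := (inferInstance : Nonempty K.FundamentalSymmetry)
  rw [strongTopology_eq J]
  exact continuousSMul_induced J.toAssoc

/-- A fundamental symmetry as a continuous operator. -/
def FundamentalSymmetry.toCLM (J : K.FundamentalSymmetry) : K →L[ℂ] K where
  toLinearMap := J.toLin
  cont := by
    let T : J.Assoc →ₗ[ℂ] J.Assoc := J.toAssoc ∘ₗ J.toLin ∘ₗ J.toAssoc.symm
    have hT : ∀ x, ‖T x‖ ≤ 1 * ‖x‖ := fun x => by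
      obtain ⟨x, rfl⟩ := J.toAssoc.surjective x
      have h1 : T (J.toAssoc x) = J.toAssoc (J x) := by simp [T]
      rw [h1, one_mul, ← sq_le_sq₀ (norm_nonneg _) (norm_nonneg _), J.norm_sq_toAssoc,
        J.norm_sq_toAssoc, J.apply_apply, J.form_symm_apply]
    have hc : Continuous T := (T.mkContinuous 1 hT).continuous
    have : (J.toLin : K → K) = J.toAssocL.symm ∘ T ∘ J.toAssocL := by
      funext x
      rfl
    change Continuous (J.toLin : K → K)
    rw [this]
    exact J.toAssocL.symm.continuous.comp (hc.comp J.toAssocL.continuous)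

variable {L : KreinSpace.{w}}

theorem exists_adjoint (T : K →L[ℂ] L) :
    ∃ S : L →L[ℂ] K, ∀ x y, L.form (T x) y = K.form x (S y) := by
  obtain ⟨J⟩ := (inferInstance : Nonempty K.FundamentalSymmetry)
  obtain ⟨J'⟩ := (inferInstance : Nonempty L.FundamentalSymmetry)
  let A : J.Assoc →L[ℂ] J'.Assoc := (J'.toAssocL : L →L[ℂ] J'.Assoc) ∘L T ∘L (J.toAssocL.symm : J.Assoc →L[ℂ] K)
  refine ⟨J.toCLM ∘L (J.toAssocL.symm : J.Assoc →L[ℂ] K) ∘L A.adjoint ∘L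
    (J'.toAssocL : L →L[ℂ] J'.Assoc) ∘L J'.toCLM,
    fun x y => ?_⟩
  have h := A.adjoint_inner_right (J.toAssoc x) (J'.toAssoc (J' y))
  have h1 : inner ℂ (A (J.toAssoc x)) (J'.toAssoc (J' y)) = L.form (T x) y := by
    have : A (J.toAssoc x) = J'.toAssoc (T x) := rfl
    rw [this, J'.inner_toAssoc, J'.apply_apply]
  rw [← h1, ← h]
  rfl

/-- The Krein space adjoint: `⟨T x, y⟩ = ⟨x, T* y⟩`. -/
def adjoint (T : K →L[ℂ] L) : L →L[ℂ] K := (exists_adjoint T).choose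

theorem form_adjoint (T : K →L[ℂ] L) (x : K) (y : L) :
    L.form (T x) y = K.form x (adjoint T y) := (exists_adjoint T).choose_spec x y

theorem eq_of_form_right {x y : K} (h : ∀ z, K.form z x = K.form z y) : x = y :=
  FundamentalSymmetry.eq_of_form_left fun z => by
    rw [← K.form_symm z x, ← K.form_symm z y, h]

theorem eq_adjoint {T : K →L[ℂ] L} {S : L →L[ℂ] K}
    (h : ∀ x y, L.form (T x) y = K.form x (S y)) : adjoint T = S :=
  ContinuousLinearMap.ext fun y => eq_of_form_right fun x => by rw [← form_adjoint, h]

end KreinSpace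

/-! ### The star-category `B(𝔎)` of a family of Krein spaces -/

/-- The objects of the category `B(𝔎)` of a family `𝔎 = (K i)` of Krein spaces: the members of
the family. -/
@[ext] structure BK {ι : Type u} (K : ι → KreinSpace.{w}) : Type u where
  idx : ι

namespace BK

variable {ι : Type u} {K : ι → KreinSpace.{w}}

/-- Morphisms of `B(𝔎)` are the continuous linear maps. -/
instance : Category.{w} (BK K) where
  Hom X Y := K X.idx →L[ℂ] K Y.idx
  id X := ContinuousLinearMap.id ℂ (K X.idx)
  comp S T := ContinuousLinearMap.comp T S

instance : Preadditive (BK K) where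
  homGroup X Y := inferInstanceAs (AddCommGroup (K X.idx →L[ℂ] K Y.idx))
  add_comp _ _ _ S T R := ContinuousLinearMap.comp_add R S T
  comp_add _ _ _ S T R := ContinuousLinearMap.add_comp T R S

instance : Linear ℂ (BK K) where
  homModule X Y := inferInstanceAs (Module ℂ (K X.idx →L[ℂ] K Y.idx))
  smul_comp _ _ _ c S T := ContinuousLinearMap.comp_smul T c S
  comp_smul _ _ _ S c T := ContinuousLinearMap.smul_comp c T S

/-- The involution of `B(𝔎)` is the Krein space adjoint. -/
instance : StarCategory (BK K) where
  star T := KreinSpace.adjoint T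
  star_star {X Y} T := KreinSpace.eq_adjoint fun x y => by
    rw [← (K X.idx).form_symm, ← (K Y.idx).form_symm]
    exact congrArg _ (KreinSpace.form_adjoint T y x).symm
  star_add {X Y} S T := KreinSpace.eq_adjoint fun x y => by
    change (K Y.idx).form (S.toFun x + T.toFun x) y =
      (K X.idx).form x (KreinSpace.adjoint S y + KreinSpace.adjoint T y)
    rw [map_add, map_add, LinearMap.add_apply, ← KreinSpace.form_adjoint,
      ← KreinSpace.form_adjoint]
    rfl
  star_smul {X Y} c T := KreinSpace.eq_adjoint fun x y => by
    change (K Y.idx).form (c • T.toFun x) y =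
      (K X.idx).form x ((starRingEnd ℂ c) • KreinSpace.adjoint T y)
    rw [LinearMap.map_smulₛₗ, map_smul, LinearMap.smul_apply, ← KreinSpace.form_adjoint]
    rfl
  star_comp {X Y Z} S T := KreinSpace.eq_adjoint fun x y => by
    change (K Z.idx).form (T.toFun (S.toFun x)) y =
      (K X.idx).form x (KreinSpace.adjoint S (KreinSpace.adjoint T y))
    rw [← KreinSpace.form_adjoint, ← KreinSpace.form_adjoint]
    rfl

/-- A star-subcategory of `B(𝔎)` is closed if each of its spaces of morphisms is closed in the
topology of bounded convergence of `B(K i, K j)`, which is the one given by the operator norm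
for any choice of fundamental symmetries of `K i` and `K j`. -/
def IsClosedSubcategory (S : StarSubcategory (BK K)) : Prop :=
  ∀ X Y : BK K, IsClosed {T : K X.idx →L[ℂ] K Y.idx | T ∈ S.hom X Y}

/-- `α_J (T) = J T J`, for a family `J` of fundamental symmetries of the Krein spaces of `𝔎`. -/
def conj (J : ∀ i, (K i).FundamentalSymmetry) : Involution (BK K) where
  map {X Y} :=
    { toFun := fun T : K X.idx →L[ℂ] K Y.idx => (J Y.idx).toCLM ∘L T ∘L (J X.idx).toCLM
      map_add' := fun S T => ContinuousLinearMap.ext fun x => map_add (J Y.idx).toCLM _ _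
      map_smul' := fun c T => ContinuousLinearMap.ext fun x => map_smul (J Y.idx).toCLM _ _ }
  map_id X := ContinuousLinearMap.ext fun x => (J X.idx).apply_apply x
  map_comp {X Y Z} S T := ContinuousLinearMap.ext fun x => by
    change (J Z.idx) (T.toFun (S.toFun ((J X.idx) x))) =
      (J Z.idx) (T.toFun ((J Y.idx) ((J Y.idx) (S.toFun ((J X.idx) x)))))
    rw [(J Y.idx).apply_apply]
  map_star {X Y} T := (KreinSpace.eq_adjoint fun x y => by
    change (K Y.idx).form ((J Y.idx) (T.toFun ((J X.idx) x))) y =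
      (K X.idx).form x ((J X.idx) (KreinSpace.adjoint T ((J Y.idx) y)))
    rw [(J Y.idx).form_symm_apply, ← (J X.idx).form_symm_apply, ← KreinSpace.form_adjoint]
    rfl).symm
  map_map {X Y} T := ContinuousLinearMap.ext fun x => by
    change (J Y.idx) ((J Y.idx) (T.toFun ((J X.idx) ((J X.idx) x)))) = T.toFun x
    rw [(J Y.idx).apply_apply, (J X.idx).apply_apply]

end BK

end Krein

end

/-! Put `x† = α(x*)`. Since `α` is an involution commuting with `*`, this is again an involution,
and the hypotheses say that the category with `†` is a C*-category; `*` is recovered as `α(x†)`. The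
theorem is then a Gelfand–Naimark theorem carried out equivariantly for `α`.

The given norms satisfy only the C*-identity. Polarization makes them submultiplicative up to a
constant (`norm_end_comp_le`), so Gelfand's formula identifies the norm of a Hermitian element with
its spectral radius (`IsCStarNorm.spectralRadius_eq`). Hence the norm is determined by the algebra,
and both `†` and `α` are isometric.

Positivity of the spectrum of `p = x†x` gives `‖2p - ‖p‖‖ ≤ ‖p‖`, so a contractive functional with
value 1 at the unit is positive. Hahn–Banach provides such a functional attaining the norm at `p`;
averaging it over `α` yields an invariant state that still sees at least half of `‖x‖²`
(`exists_state`).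

The GNS construction is applied to all invariant states of all the algebras `End X` at once: the
space over `Y` is the completed direct sum of the `Hom(X, Y)`, on which morphisms act by
composition. This action is bounded by `re_comp_le`. Invariance of the states makes `α` act as a
self-adjoint unitary `U`, and `⟨x, U y⟩` is a Kreĭn form with fundamental symmetry `U`. The Kreĭn
adjoint of the image of `x` is then the image of `α(x†) = x*`. The two-sided estimate `‖π(x)‖ ≤ ‖x‖
≤ 2‖π(x)‖` gives faithfulness and closed range. -/

noncomputable section

namespace Krein

open StarCategory (star)

/-! ### Gelfand's formula and a growth lemma -/

/-- The Gelfand formula for a complete norm that is submultiplicative up to a constant. -/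
theorem spectralRadius_eq_of_norm_pow {A : Type*} [Ring A] [Algebra ℂ A] (N : Seminorm ℂ A)
    (hN : IsBanachNorm N) {k : ℝ} (hk : 0 < k) (hmul : ∀ x y, N (x * y) ≤ k * (N x * N y))
    {h : A} (hpow : ∀ n : ℕ, N (h ^ 2 ^ n) = N h ^ 2 ^ n) :
    spectralRadius ℂ h = ENNReal.ofReal (N h) := by
  -- The rescaled norm `k * N` is genuinely submultiplicative.
  let _ : NormedAddCommGroup A := AddGroupNorm.toNormedAddCommGroup
    { toFun := fun x => k * N x
      map_zero' := by simp
      add_le' := fun x y => by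
        rw [← mul_add]; exact mul_le_mul_of_nonneg_left (map_add_le_add N x y) hk.le
      neg' := fun x => by rw [map_neg_eq_map]
      eq_zero_of_map_eq_zero' := fun x hx => hN.eq_zero x <| by
        rcases mul_eq_zero.1 hx with h | h
        · exact absurd h hk.ne'
        · exact h }
  have norm_def : ∀ x : A, ‖x‖ = k * N x := fun _ => rfl
  let _ : NormedRing A := { ‹NormedAddCommGroup A›, ‹Ring A› with
    norm_mul_le := fun x y => by
      change k * N (x * y) ≤ k * N x * (k * N y)
      calc k * N (x * y) ≤ k * (k * (N x * N y)) := mul_le_mul_of_nonneg_left (hmul x y) hk.le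
        _ = _ := by ring }
  let _ : NormedAlgebra ℂ A := { ‹Algebra ℂ A› with
    norm_smul_le := fun c x => by
      change k * N (c • x) ≤ ‖c‖ * (k * N x)
      rw [map_smul_eq_mul]; exact le_of_eq (by ring) }
  have : CompleteSpace A := by
    refine Metric.complete_of_cauchySeq_tendsto fun s hs => ?_
    obtain ⟨x, hx⟩ := hN.complete s fun ε hε => by
      obtain ⟨n₀, h₀⟩ := Metric.cauchySeq_iff.1 hs (k * ε) (mul_pos hk hε)
      refine ⟨n₀, fun m hm n hn => ?_⟩
      have := h₀ m hm n hn
      rw [dist_eq_norm] at this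
      exact lt_of_mul_lt_mul_left this hk.le
    refine ⟨x, tendsto_iff_norm_sub_tendsto_zero.2 ?_⟩
    have := hx.const_mul k
    rwa [mul_zero] at this
  have h1 := (spectrum.pow_norm_pow_one_div_tendsto_nhds_spectralRadius h).comp
    (tendsto_pow_atTop_atTop_of_one_lt (r := 2) (by norm_num))
  refine tendsto_nhds_unique h1 ?_
  -- Along the exponents `2 ^ n` the roots of the norms are `k ^ (1 / 2 ^ n) * N h`, so the constant
  -- disappears in the limit.
  have h2 : Filter.Tendsto (fun n : ℕ => k ^ ((1 / 2 : ℝ) ^ n) * N h) Filter.atTop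
      (nhds (k ^ (0 : ℝ) * N h)) :=
    ((Real.continuousAt_const_rpow hk.ne').tendsto.comp
      (tendsto_pow_atTop_nhds_zero_of_lt_one (by norm_num) (by norm_num))).mul_const _
  rw [Real.rpow_zero, one_mul] at h2
  refine (ENNReal.tendsto_ofReal h2).congr fun n => ?_
  have h3 : (1 / 2 : ℝ) ^ n = 1 / ((2 ^ n : ℕ) : ℝ) := by push_cast; simp
  simp only [Function.comp_apply]
  rw [norm_def, hpow, Real.mul_rpow hk.le (by positivity), h3, one_div,
    Real.pow_rpow_inv_natCast (apply_nonneg N h) (by positivity)]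

/-- Geometric growth forces a bound on the first term of a sequence with `g n ^ 2 ≤ g (n + 1)`. -/
theorem le_of_sq_le_succ {g : ℕ → ℝ} {K R : ℝ} (hR : 0 ≤ R) (hg : ∀ n, 0 ≤ g n)
    (hsq : ∀ n, g n ^ 2 ≤ g (n + 1)) (hb : ∀ n, g n ≤ K * R ^ 2 ^ n) : g 0 ≤ R := by
  have hpow : ∀ n, g 0 ^ 2 ^ n ≤ g n := fun n => by
    induction n with
    | zero => simp
    | succ n ih =>
      rw [pow_succ, pow_mul]
      exact (pow_le_pow_left₀ (pow_nonneg (hg 0) _) ih 2).trans (hsq n)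
  by_contra! hlt
  -- The ratio `g 0 / R` needs `R > 0`; for `R = 0` the bound at `n = 0` is already enough.
  rcases hR.eq_or_lt with rfl | hR
  · have := (hpow 0).trans (hb 0)
    simp at this
    linarith
  have h1 : 1 < g 0 / R := (one_lt_div hR).2 hlt
  have h2 := (tendsto_pow_atTop_atTop_of_one_lt h1).comp
    (tendsto_pow_atTop_atTop_of_one_lt (r := 2) (by norm_num : 1 < 2))
  obtain ⟨n, hn⟩ := (h2.eventually (Filter.eventually_gt_atTop K)).exists
  have h3 := (hpow n).trans (hb n)
  simp only [Function.comp_apply, div_pow] at hn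
  rw [lt_div_iff₀ (by positivity)] at hn
  linarith

/-! ### The involution `x† = α(x*)` -/

namespace Involution

variable {C : Type u} [Category.{v} C] [Preadditive C] [Linear ℂ C] [StarCategory C]

/-- The involution `x ↦ α(x*)`, for which `C` is a C*-category. -/
def dag (α : Involution C) {X Y : C} (x : X ⟶ Y) : Y ⟶ X := α.map (star x)

variable (α : Involution C) {X Y Z : C}

theorem dag_dag (x : X ⟶ Y) : α.dag (α.dag x) = x := by
  rw [dag, dag, ← α.map_star, α.map_map, StarCategory.star_star]

theorem dag_add (x y : X ⟶ Y) : α.dag (x + y) = α.dag x + α.dag y := by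
  rw [dag, StarCategory.star_add, map_add]; rfl

theorem dag_smul (c : ℂ) (x : X ⟶ Y) : α.dag (c • x) = (starRingEnd ℂ c) • α.dag x := by
  rw [dag, StarCategory.star_smul, map_smul]; rfl

theorem dag_comp (x : X ⟶ Y) (y : Y ⟶ Z) : α.dag (x ≫ y) = α.dag y ≫ α.dag x := by
  rw [dag, StarCategory.star_comp, α.map_comp]; rfl

theorem dag_neg (x : X ⟶ Y) : α.dag (-x) = -α.dag x := by
  rw [← neg_one_smul ℂ x, dag_smul]; simp

theorem dag_sub (x y : X ⟶ Y) : α.dag (x - y) = α.dag x - α.dag y := by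
  rw [sub_eq_add_neg, dag_add, dag_neg, sub_eq_add_neg]

theorem dag_id (X : C) : α.dag (𝟙 X) = 𝟙 X := by
  have h := α.dag_comp (α.dag (𝟙 X)) (𝟙 X)
  rw [Category.comp_id, α.dag_dag, Category.comp_id] at h
  exact h.symm

theorem map_dag (x : X ⟶ Y) : α.map (α.dag x) = α.dag (α.map x) := by
  rw [dag, dag, α.map_star]

/-- The C*-identity controls only products of the form `z ≫ z†`; this writes an arbitrary `y ≫ x†`
through four of them. -/
theorem polarization (x y : X ⟶ Y) :
    (4 : ℂ) • (y ≫ α.dag x) =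
      (x + y) ≫ α.dag (x + y) - (x - y) ≫ α.dag (x - y)
        + Complex.I • ((x - Complex.I • y) ≫ α.dag (x - Complex.I • y))
        - Complex.I • ((x + Complex.I • y) ≫ α.dag (x + Complex.I • y)) := by
  simp only [dag_add, dag_sub, dag_smul, Preadditive.add_comp, Preadditive.comp_add,
    Preadditive.sub_comp, Preadditive.comp_sub, Linear.smul_comp, Linear.comp_smul,
    Complex.conj_I]
  match_scalars <;> ring_nf <;> norm_num [Complex.I_sq]

end Involution

/-! ### Spectra of `xy` and `yx` -/

section

variable {C : Type u} [Category.{v} C] [Preadditive C] [Linear ℂ C]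

/-- Jacobson's formula: if `b` inverts `μ - y ≫ x`, then `μ⁻¹ (1 + x ≫ b ≫ y)` inverts `μ - x ≫ y`.
It relates endomorphisms of two different objects. -/
theorem spectrum_comp_subset {X Y : C} (x : X ⟶ Y) (y : Y ⟶ X) {μ : ℂ} (hμ : μ ≠ 0)
    (h : μ ∈ spectrum ℂ (A := End X) (x ≫ y)) : μ ∈ spectrum ℂ (A := End Y) (y ≫ x) := by
  rw [spectrum.mem_iff] at h ⊢
  contrapose! h
  rw [Algebra.algebraMap_eq_smul_one] at h ⊢
  obtain ⟨b, hab, hba⟩ : ∃ b : Y ⟶ Y, b ≫ (μ • 𝟙 Y - y ≫ x) = 𝟙 Y ∧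
      (μ • 𝟙 Y - y ≫ x) ≫ b = 𝟙 Y := by
    obtain ⟨⟨a, b, hab, hba⟩, ha⟩ := h
    obtain rfl : a = _ := ha
    exact ⟨b, hab, hba⟩
  simp only [Preadditive.comp_sub, Linear.comp_smul, Category.comp_id] at hab
  simp only [Preadditive.sub_comp, Linear.smul_comp, Category.id_comp, Category.assoc] at hba
  have hab' : b ≫ y ≫ x = μ • b - 𝟙 Y := by rw [← hab]; abel
  have hba' : y ≫ x ≫ b = μ • b - 𝟙 Y := by rw [← hba]; abel
  have h1 : (x ≫ b ≫ y) ≫ x ≫ y = μ • (x ≫ b ≫ y) - x ≫ y := by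
    have := congrArg (fun t => x ≫ t ≫ y) hab'
    simpa [Preadditive.comp_sub, Preadditive.sub_comp] using this
  have h2 : (x ≫ y) ≫ x ≫ b ≫ y = μ • (x ≫ b ≫ y) - x ≫ y := by
    have := congrArg (fun t => x ≫ t ≫ y) hba'
    simpa [Preadditive.comp_sub, Preadditive.sub_comp] using this
  refine ⟨⟨μ • 𝟙 X - x ≫ y, μ⁻¹ • (𝟙 X + x ≫ b ≫ y), ?_, ?_⟩, rfl⟩
  · change (μ⁻¹ • (𝟙 X + x ≫ b ≫ y)) ≫ (μ • 𝟙 X - x ≫ y) = 𝟙 X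
    rw [Linear.smul_comp, Preadditive.comp_sub, Preadditive.add_comp _ _ _ _ _ (x ≫ y), h1]
    simp [hμ]
  · change (μ • 𝟙 X - x ≫ y) ≫ (μ⁻¹ • (𝟙 X + x ≫ b ≫ y)) = 𝟙 X
    rw [Linear.comp_smul, Preadditive.sub_comp, Preadditive.comp_add _ _ _ (x ≫ y), h2]
    simp [hμ]

end

/-! ### Norm estimates from the C*-identity -/

namespace Involution

variable {C : Type u} [Category.{v} C] [Preadditive C] [Linear ℂ C] [StarCategory C]

theorem dag_comp_dag_self (α : Involution C) {X Y : C} (x : X ⟶ Y) :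
    α.dag (x ≫ α.dag x) = x ≫ α.dag x := by
  rw [dag_comp, dag_dag]

/-- The family `N` of norms witnesses that `α` is a fundamental symmetry. -/
structure IsCStarNorm (α : Involution C) (N : ∀ X Y : C, Seminorm ℂ (X ⟶ Y)) : Prop where
  banach : ∀ X Y, IsBanachNorm (N X Y)
  cstar : ∀ {X Y : C} (x : X ⟶ Y), N X X (x ≫ α.dag x) = N X Y x ^ 2
  pos : ∀ {X Y : C} (x : X ⟶ Y), α.IsPositive (x ≫ α.dag x)

theorem IsFundamentalSymmetry.exists_norm {α : Involution C} (h : α.IsFundamentalSymmetry) :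
    ∃ N : ∀ X Y : C, Seminorm ℂ (X ⟶ Y), α.IsCStarNorm N := by
  obtain ⟨⟨N, h1, h2⟩, h3⟩ := h
  exact ⟨N, h1, h2, h3⟩

/-- `α` as an algebra automorphism of `End X`. -/
def endEquiv (α : Involution C) (X : C) : End X ≃ₐ[ℂ] End X :=
  AlgEquiv.ofLinearEquiv (LinearEquiv.ofInvolutive (α.map : (X ⟶ X) →ₗ[ℂ] (X ⟶ X)) α.map_map)
    (α.map_id X) fun x y => α.map_comp y x

namespace IsCStarNorm

variable {α : Involution C} {N : ∀ X Y : C, Seminorm ℂ (X ⟶ Y)} (hN : α.IsCStarNorm N)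
  {X Y Z : C}

include hN

/-- The C*-identity gives `N 𝟙 = (N 𝟙)²`. The value 0 cannot be excluded, since `X` may be a zero
object. -/
theorem norm_id_le (X : C) : N X X (𝟙 X) ≤ 1 := by
  have h := hN.cstar (𝟙 X)
  rw [α.dag_id, Category.comp_id] at h
  nlinarith [apply_nonneg (N X X) (𝟙 X)]

theorem norm_comp_dag_le_sq (x y : X ⟶ Y) :
    N X X (y ≫ α.dag x) ≤ (N X Y x + N X Y y) ^ 2 := by
  have key : ∀ z : X ⟶ Y, N X Y z ≤ N X Y x + N X Y y →
      N X X (z ≫ α.dag z) ≤ (N X Y x + N X Y y) ^ 2 := fun z hz => by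
    rw [hN.cstar]
    exact pow_le_pow_left₀ (apply_nonneg _ _) hz 2
  have hI : N X Y (Complex.I • y) = N X Y y := by rw [map_smul_eq_mul]; simp
  have h1 := key (x + y) (map_add_le_add _ _ _)
  have h2 := key (x - y) (map_sub_le_add _ _ _)
  have h3 := key (x - Complex.I • y) ((map_sub_le_add _ _ _).trans_eq (by rw [hI]))
  have h4 := key (x + Complex.I • y) ((map_add_le_add _ _ _).trans_eq (by rw [hI]))
  have hI' : ∀ z : X ⟶ X, N X X (Complex.I • z) = N X X z := fun z => by
    rw [map_smul_eq_mul]; simp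
  have h5 : N X X ((4 : ℂ) • (y ≫ α.dag x)) = 4 * N X X (y ≫ α.dag x) := by
    rw [map_smul_eq_mul]; norm_num
  rw [α.polarization] at h5
  have h6 := map_sub_le_add (N X X) ((x + y) ≫ α.dag (x + y) - (x - y) ≫ α.dag (x - y)
        + Complex.I • ((x - Complex.I • y) ≫ α.dag (x - Complex.I • y)))
        (Complex.I • ((x + Complex.I • y) ≫ α.dag (x + Complex.I • y)))
  have h7 := map_add_le_add (N X X) ((x + y) ≫ α.dag (x + y) - (x - y) ≫ α.dag (x - y))
        (Complex.I • ((x - Complex.I • y) ≫ α.dag (x - Complex.I • y)))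
  have h8 := map_sub_le_add (N X X) ((x + y) ≫ α.dag (x + y)) ((x - y) ≫ α.dag (x - y))
  rw [hI'] at h6 h7
  linarith

theorem norm_comp_dag_le (x y : X ⟶ Y) :
    N X X (y ≫ α.dag x) ≤ 4 * (N X Y x * N X Y y) := by
  rcases (apply_nonneg (N X Y) x).eq_or_lt with hx | hx
  · rw [(hN.banach X Y).eq_zero x hx.symm, ← zero_smul ℂ (0 : X ⟶ Y), dag_smul]
    simp
  rcases (apply_nonneg (N X Y) y).eq_or_lt with hy | hy
  · rw [(hN.banach X Y).eq_zero y hy.symm]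
    simp
  -- Rescale `y` to have the norm of `x`, so that the right-hand side becomes `(2 N x)²`; this is
  -- the origin of the constant 4.
  have h := hN.norm_comp_dag_le_sq x (((N X Y x / N X Y y : ℝ) : ℂ) • y)
  rw [Linear.smul_comp, map_smul_eq_mul, map_smul_eq_mul, Complex.norm_real, Real.norm_of_nonneg
    (by positivity), div_mul_cancel₀ _ hy.ne', div_mul_eq_mul_div, div_le_iff₀ hy] at h
  refine le_of_mul_le_mul_left ?_ hx
  linarith

/-- Writing `y` as `(y†)†` costs one factor 4, and comparing `N (y†)` with `N y` costs another. The
constant is harmless, since Gelfand's formula absorbs it. -/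
theorem norm_end_comp_le (x y : X ⟶ X) :
    N X X (x ≫ y) ≤ 16 * (N X X x * N X X y) := by
  have h1 := hN.norm_comp_dag_le (α.dag y) x
  have h2 := hN.norm_comp_dag_le y (𝟙 X)
  rw [α.dag_dag] at h1
  rw [Category.id_comp] at h2
  have h3 := hN.norm_id_le X
  have hy := apply_nonneg (N X X) y
  have hx := apply_nonneg (N X X) x
  have h4 : N X X (α.dag y) ≤ 4 * N X X y := by nlinarith
  nlinarith

/-- For a Hermitian element the C*-identity computes the norm of its square, hence that of its
powers with exponents `2 ^ n`; these suffice for Gelfand's formula. -/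
theorem norm_pow {h : End X} (hh : α.dag h = h) (n : ℕ) :
    N X X (h ^ 2 ^ n : End X) = N X X h ^ 2 ^ n ∧
      α.dag (h ^ 2 ^ n : End X) = (h ^ 2 ^ n : End X) := by
  induction n with
  | zero => simp [hh]
  | succ n ih =>
    have h1 : (h ^ 2 ^ (n + 1) : End X) = (h ^ 2 ^ n : End X) ≫ (h ^ 2 ^ n : End X) := by
      rw [pow_succ, pow_mul, sq]; rfl
    constructor
    · have := hN.cstar (h ^ 2 ^ n : End X)
      rw [ih.2, ih.1] at this
      rw [h1, this, pow_succ 2 n, pow_mul]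
    · rw [h1, dag_comp, ih.2]

theorem spectralRadius_eq {h : X ⟶ X} (hh : α.dag h = h) :
    spectralRadius ℂ (A := End X) h = ENNReal.ofReal (N X X h) :=
  spectralRadius_eq_of_norm_pow (A := End X) (N X X) (hN.banach X X) (k := 16) (by norm_num)
    (fun x y => by
      rw [mul_comm (N X X x)]
      exact hN.norm_end_comp_le y x) fun n => (hN.norm_pow hh n).1

theorem norm_le_of_spectrum {h : X ⟶ X} (hh : α.dag h = h) {R : ℝ} (hR : 0 ≤ R)
    (hs : ∀ μ ∈ spectrum ℂ (A := End X) h, ‖μ‖ ≤ R) : N X X h ≤ R := by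
  rw [← ENNReal.ofReal_le_ofReal_iff hR, ← hN.spectralRadius_eq hh]
  refine iSup₂_le fun μ hμ => ?_
  rw [← enorm_eq_nnnorm, ← ofReal_norm]
  exact ENNReal.ofReal_le_ofReal (hs μ hμ)

theorem norm_spectrum_le {h : X ⟶ X} (hh : α.dag h = h) {μ : ℂ}
    (hμ : μ ∈ spectrum ℂ (A := End X) h) : ‖μ‖ ≤ N X X h := by
  rw [← ENNReal.ofReal_le_ofReal_iff (apply_nonneg _ _), ← hN.spectralRadius_eq hh,
    ofReal_norm, enorm_eq_nnnorm]
  exact le_iSup₂ (f := fun (k : ℂ) (_ : k ∈ spectrum ℂ (A := End X) h) => (‖k‖₊ : ENNReal)) μ hμ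

/-- The squares of the two norms are the spectral radii of `x ≫ x†` and `x† ≫ x`, whose spectra
agree away from 0. -/
theorem norm_dag_le (x : X ⟶ Y) : N X Y x ≤ N Y X (α.dag x) := by
  rw [← sq_le_sq₀ (apply_nonneg _ _) (apply_nonneg _ _), ← hN.cstar x]
  refine hN.norm_le_of_spectrum (α.dag_comp_dag_self x) (by positivity) fun μ hμ => ?_
  rcases eq_or_ne μ 0 with rfl | h0
  · rw [norm_zero]; positivity
  have h1 := hN.cstar (α.dag x)
  have h2 := α.dag_comp_dag_self (α.dag x)
  rw [dag_dag] at h1 h2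
  rw [← h1]
  exact hN.norm_spectrum_le h2 (spectrum_comp_subset _ _ h0 hμ)

theorem norm_dag (x : X ⟶ Y) : N Y X (α.dag x) = N X Y x := by
  refine le_antisymm ?_ (hN.norm_dag_le x)
  have := hN.norm_dag_le (α.dag x)
  rwa [dag_dag] at this

/-- `α` restricts to an algebra automorphism of `End X` commuting with `†`; it preserves spectra,
hence the norms of Hermitian elements. -/
theorem norm_map_le (x : X ⟶ Y) : N X Y (α.map x) ≤ N X Y x := by
  rw [← sq_le_sq₀ (apply_nonneg _ _) (apply_nonneg _ _), ← hN.cstar x, ← hN.cstar, ← α.map_dag,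
    ← α.map_comp]
  refine hN.norm_le_of_spectrum ?_ (apply_nonneg _ _) fun μ hμ => ?_
  · rw [← map_dag, α.dag_comp_dag_self]
  · refine hN.norm_spectrum_le (α.dag_comp_dag_self x) ?_
    rwa [← AlgEquiv.spectrum_eq (α.endEquiv X)]

theorem norm_comp_end_le (a : X ⟶ Y) (k : Y ⟶ Y) :
    N X Y (a ≫ k) ≤ 16 * (N X Y a * N Y Y k) := by
  have ha := apply_nonneg (N X Y) a
  have hk := apply_nonneg (N Y Y) k
  rw [← sq_le_sq₀ (apply_nonneg _ _) (by positivity), ← hN.norm_dag, ← hN.cstar, dag_dag, dag_comp,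
    Category.assoc]
  have h1 := hN.norm_end_comp_le (α.dag k) (α.dag a ≫ a ≫ k)
  have h2 := hN.norm_end_comp_le (α.dag a ≫ a) k
  have h3 := hN.cstar (α.dag a)
  rw [dag_dag, hN.norm_dag] at h3
  rw [h3, Category.assoc] at h2
  rw [hN.norm_dag] at h1
  calc _ ≤ 16 * (N Y Y k * N Y Y (α.dag a ≫ a ≫ k)) := h1
    _ ≤ 16 * (N Y Y k * (16 * (N X Y a ^ 2 * N Y Y k))) := by gcongr
    _ = _ := by ring

/-- If `p = x† x` then `‖2 p - ‖p‖‖ ≤ ‖p‖`. -/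
theorem norm_two_smul_sub_le (x : X ⟶ Y) :
    N X X ((2 : ℂ) • (x ≫ α.dag x) - ((N X Y x ^ 2 : ℝ) : ℂ) • 𝟙 X) ≤ N X Y x ^ 2 := by
  refine hN.norm_le_of_spectrum ?_ (by positivity) fun μ hμ => ?_
  · rw [dag_sub, dag_smul, dag_smul, α.dag_comp_dag_self, dag_id, Complex.conj_ofReal, map_ofNat]
  set p : End X := x ≫ α.dag x
  set n := N X Y x ^ 2
  -- Spectral mapping for `t ↦ 2t - n`. As `p` has its spectrum in `[0, n]`, the image lies in `[-n,
  -- n]`.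
  have h1 : (μ + n) / 2 ∈ spectrum ℂ p := by
    rw [spectrum.mem_iff, Algebra.algebraMap_eq_smul_one] at hμ ⊢
    contrapose! hμ
    have h2 := hμ.smul (Units.mk0 (2 : ℂ) two_ne_zero)
    have h3 : (Units.mk0 (2 : ℂ) two_ne_zero) • (((μ + n) / 2) • (1 : End X) - p) =
        μ • (1 : End X) - ((2 : ℂ) • p - (n : ℂ) • (1 : End X)) := by
      change (2 : ℂ) • (((μ + n) / 2) • (1 : End X) - p) = _
      module
    rwa [h3] at h2
  obtain ⟨h4, h5⟩ := (hN.pos x).2 _ h1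
  have h6 := hN.norm_spectrum_le (α.dag_comp_dag_self x) h1
  rw [hN.cstar] at h6
  have h7 := (Complex.re_le_norm _).trans h6
  have hμ' : μ = (2 * ((μ + n) / 2).re - n : ℝ) := by
    have h8 : (μ + n) / 2 = (((μ + n) / 2).re : ℂ) := Complex.ext rfl (by simpa using h5)
    push_cast
    rw [← h8]
    ring
  rw [hμ', Complex.norm_real, Real.norm_eq_abs, abs_le]
  constructor <;> linarith

end IsCStarNorm
-- Invariant states
/-- The `α`-invariant positive functionals on `End X` that are bounded by the norm. -/
structure InvariantState (α : Involution C) (N : ∀ X Y : C, Seminorm ℂ (X ⟶ Y)) (X : C) where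
  toLin : (X ⟶ X) →ₗ[ℂ] ℂ
  dag_apply : ∀ h, toLin (α.dag h) = starRingEnd ℂ (toLin h)
  map_apply : ∀ h, toLin (α.map h) = toLin h
  nonneg : ∀ {Y : C} (x : X ⟶ Y), 0 ≤ (toLin (x ≫ α.dag x)).re
  norm_le : ∀ h, ‖toLin h‖ ≤ N X X h

namespace IsCStarNorm

variable {α : Involution C} {N : ∀ X Y : C, Seminorm ℂ (X ⟶ Y)} (hN : α.IsCStarNorm N)
  {X Y Z : C}

include hN

/-- With `p = y ≫ y†` and `n = ‖p‖`, contractivity at `2p - n` gives `|2 Re g(p) - n| ≤ n`, so `Re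
g(p) ≥ 0`. -/
theorem re_nonneg_of_norm_le {g : (X ⟶ X) →ₗ[ℂ] ℂ} (hg : ∀ h, ‖g h‖ ≤ N X X h)
    (h1 : g (𝟙 X) = 1) (y : X ⟶ Y) : 0 ≤ (g (y ≫ α.dag y)).re := by
  have h2 := (Complex.abs_re_le_norm _).trans ((hg _).trans (hN.norm_two_smul_sub_le y))
  rw [map_sub, map_smul, map_smul, h1, abs_le] at h2
  simp only [smul_eq_mul, mul_one, Complex.sub_re, Complex.mul_re, Complex.ofReal_re,
    Complex.re_ofNat, Complex.im_ofNat, zero_mul, sub_zero] at h2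
  linarith

/-- By the Hahn-Banach theorem, the states of `End X` attain the norm of `x† x`. -/
theorem exists_positive_functional (x : X ⟶ Y) (hx : x ≠ 0) :
    ∃ g : (X ⟶ X) →ₗ[ℂ] ℂ, (∀ h, ‖g h‖ ≤ N X X h) ∧ g (𝟙 X) = 1 ∧
      g (x ≫ α.dag x) = (N X Y x ^ 2 : ℝ) := by
  have hn : 0 < N X Y x :=
    lt_of_le_of_ne (apply_nonneg _ _) fun h => hx ((hN.banach X Y).eq_zero x h.symm)
  let _ : SeminormedAddCommGroup (X ⟶ X) :=
    AddGroupSeminorm.toSeminormedAddCommGroup (N X X).toAddGroupSeminorm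
  let _ : NormedSpace ℂ (X ⟶ X) := ⟨fun c x => (map_smul_eq_mul (N X X) c x).le⟩
  have norm_def : ∀ h : X ⟶ X, ‖h‖ = N X X h := fun _ => rfl
  obtain ⟨g, hg1, hg2⟩ := exists_dual_vector ℂ (x ≫ α.dag x) (by
    rw [norm_def, hN.cstar]; positivity)
  have hg : ∀ h, ‖g h‖ ≤ N X X h := fun h => by
    have := g.le_opNorm h
    rwa [hg1, one_mul, norm_def] at this
  rw [norm_def, hN.cstar] at hg2
  have hg3 : g (x ≫ α.dag x) = (N X Y x ^ 2 : ℝ) := hg2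
  refine ⟨g.toLinearMap, hg, ?_, hg3⟩
  change g (𝟙 X) = 1
  -- Contractivity at `𝟙` and at `2p - ‖p‖` gives `|g(𝟙)| ≤ 1` and `|2 - g(𝟙)| ≤ 1`. The two discs
  -- meet only at 1.
  have h1 := (hg _).trans (hN.norm_id_le X)
  have h2 := (hg _).trans (hN.norm_two_smul_sub_le x)
  rw [map_sub, map_smul, map_smul, hg3, smul_eq_mul, smul_eq_mul,
    show (2 : ℂ) * (N X Y x ^ 2 : ℝ) - (N X Y x ^ 2 : ℝ) * g (𝟙 X) =
      (N X Y x ^ 2 : ℝ) * (2 - g (𝟙 X)) by ring, norm_mul, Complex.norm_real,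
    Real.norm_of_nonneg (by positivity)] at h2
  have h3 : ‖2 - g (𝟙 X)‖ ≤ 1 :=
    le_of_mul_le_mul_left (by linarith) (by positivity : 0 < N X Y x ^ 2)
  have h4 := (Complex.re_le_norm _).trans h3
  have h5 := Complex.sq_norm (g (𝟙 X))
  rw [Complex.normSq_apply] at h5
  simp only [Complex.sub_re, Complex.re_ofNat] at h4
  have h6 := (Complex.re_le_norm _).trans h1
  have h7 : (g (𝟙 X)).re = 1 := by linarith
  have h8 : (g (𝟙 X)).im = 0 := by
    have := norm_nonneg (g (𝟙 X))
    rw [h7] at h5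
    nlinarith
  exact Complex.ext h7 h8

/-- Average a norm-attaining functional over `α` and over `h ↦ conj g(h†)`. On `z ≫ z†` the real
part of the average is half of `Re g(z ≫ z†)` plus half of the same term for `α z`. Both are
nonnegative, so at least half of the value at `x ≫ x†` survives. -/
theorem exists_state (x : X ⟶ Y) (hx : x ≠ 0) :
    ∃ φ : α.InvariantState N X, N X Y x ^ 2 ≤ 2 * (φ.toLin (x ≫ α.dag x)).re := by
  obtain ⟨g, hg, h1, hgx⟩ := hN.exists_positive_functional x hx
  have hpos : ∀ {Z : C} (z : X ⟶ Z), 0 ≤ (g (z ≫ α.dag z)).re :=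
    hN.re_nonneg_of_norm_le hg h1
  have hmap : ∀ {Z : C} (z : X ⟶ Z),
      α.map (z ≫ α.dag z) = α.map z ≫ α.dag (α.map z) := fun z => by
    rw [α.map_comp, α.map_dag]
  have hre : ∀ {Z : C} (z : X ⟶ Z), ((1 / 4 : ℂ) * (g (z ≫ α.dag z)
      + starRingEnd ℂ (g (α.dag (z ≫ α.dag z))) + g (α.map (z ≫ α.dag z))
      + starRingEnd ℂ (g (α.map (α.dag (z ≫ α.dag z)))))).re =
      (1 / 2 : ℝ) * ((g (z ≫ α.dag z)).re + (g (α.map z ≫ α.dag (α.map z))).re) := fun z => by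
    rw [dag_comp_dag_self, hmap, show (1 / 4 : ℂ) = ((1 / 4 : ℝ) : ℂ) by norm_num,
      Complex.re_ofReal_mul]
    simp only [Complex.add_re, Complex.conj_re]
    ring
  refine ⟨⟨⟨⟨fun h => (1 / 4 : ℂ) * (g h + starRingEnd ℂ (g (α.dag h)) + g (α.map h)
      + starRingEnd ℂ (g (α.map (α.dag h)))), fun h k => ?_⟩, fun c h => ?_⟩,
      fun h => ?_, fun h => ?_, fun z => ?_, fun h => ?_⟩, ?_⟩
  · simp only [dag_add, map_add]; ring
  · simp only [dag_smul, map_smul, smul_eq_mul, map_mul, Complex.conj_conj, RingHom.id_apply]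
    ring
  · change (1 / 4 : ℂ) * _ = starRingEnd ℂ ((1 / 4 : ℂ) * _)
    simp only [dag_dag, map_mul, map_add, Complex.conj_conj, map_div₀, map_one, map_ofNat]
    ring
  · change (1 / 4 : ℂ) * _ = (1 / 4 : ℂ) * _
    simp only [← α.map_dag, α.map_map]
    ring
  · have h2 := hre z
    have h3 := hpos z
    have h4 := hpos (α.map z)
    change 0 ≤ Complex.re ((1 / 4 : ℂ) * _)
    rw [h2]
    linarith
  · change ‖(1 / 4 : ℂ) * _‖ ≤ _
    have h3 := hN.norm_map_le h
    have h4 := hN.norm_dag h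
    have h5 := hN.norm_map_le (α.dag h)
    rw [norm_mul, show ‖(1 / 4 : ℂ)‖ = 1 / 4 by norm_num]
    have h6 := norm_add₄_le (a := g h) (b := starRingEnd ℂ (g (α.dag h))) (c := g (α.map h))
      (d := starRingEnd ℂ (g (α.map (α.dag h))))
    rw [RCLike.norm_conj, RCLike.norm_conj] at h6
    linarith [hg h, hg (α.dag h), hg (α.map h), hg (α.map (α.dag h))]
  · change _ ≤ 2 * Complex.re ((1 / 4 : ℂ) * _)
    have h2 := hre x
    have h4 := hpos (α.map x)
    rw [h2, hgx, Complex.ofReal_re]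
    linarith

end IsCStarNorm

namespace InvariantState

variable {α : Involution C} {N : ∀ X Y : C, Seminorm ℂ (X ⟶ Y)} {X Y Z : C}
  (φ : α.InvariantState N X)

/-- The semi-inner product `φ(a† b)` on `Hom(X, Y)`. -/
@[reducible] def core (Y : C) : PreInnerProductSpace.Core ℂ (X ⟶ Y) where
  inner a b := φ.toLin (b ≫ α.dag a)
  conj_inner_symm a b := by
    rw [← φ.dag_apply, dag_comp, dag_dag]
  re_inner_nonneg a := φ.nonneg a
  add_left a b c := by rw [dag_add, Preadditive.comp_add, map_add]
  smul_left a b c := by rw [dag_smul, Linear.comp_smul, map_smul, smul_eq_mul]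

theorem re_sq_le (a b : X ⟶ Y) :
    (φ.toLin (b ≫ α.dag a)).re ^ 2 ≤
      (φ.toLin (a ≫ α.dag a)).re * (φ.toLin (b ≫ α.dag b)).re := by
  have h : ‖φ.toLin (b ≫ α.dag a)‖ * ‖φ.toLin (a ≫ α.dag b)‖ ≤
      (φ.toLin (a ≫ α.dag a)).re * (φ.toLin (b ≫ α.dag b)).re :=
    @InnerProductSpace.Core.inner_mul_inner_self_le ℂ (X ⟶ Y) _ _ _ (φ.core Y) a b
  have h2 : ‖φ.toLin (a ≫ α.dag b)‖ = ‖φ.toLin (b ≫ α.dag a)‖ := by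
    rw [← RCLike.norm_conj, ← φ.dag_apply, dag_comp, dag_dag]
  rw [h2, ← sq] at h
  refine le_trans ?_ h
  rw [← sq_abs]
  exact pow_le_pow_left₀ (abs_nonneg _) (Complex.abs_re_le_norm _) 2

/-- This makes composition with `T` bounded for the GNS seminorm. With `h = T ≫ T†` and `f n = Re
φ(a ≫ h ^ 2 ^ n ≫ a†)`, Cauchy–Schwarz gives `f n ² ≤ D * f (n + 1)`, while the crude norm estimates
give `f n ≤ const * (N T ²) ^ 2 ^ n`. Iteration removes the constant, without square roots of
positive elements. -/
theorem re_comp_le (hN : α.IsCStarNorm N) (a : X ⟶ Y) (T : Y ⟶ Z) :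
    (φ.toLin ((a ≫ T) ≫ α.dag (a ≫ T))).re ≤ N Y Z T ^ 2 * (φ.toLin (a ≫ α.dag a)).re := by
  set D := (φ.toLin (a ≫ α.dag a)).re with hD
  have hD0 : 0 ≤ D := φ.nonneg a
  let h : End Y := T ≫ α.dag T
  have hh : α.dag h = h := α.dag_comp_dag_self T
  let f : ℕ → ℝ := fun n => (φ.toLin ((a ≫ (h ^ 2 ^ n : End Y)) ≫ α.dag a)).re
  have f0 : f 0 = (φ.toLin ((a ≫ T) ≫ α.dag (a ≫ T))).re := by
    simp only [f, h, pow_zero, pow_one, dag_comp, Category.assoc]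
  have fsucc : ∀ n, f (n + 1) = (φ.toLin ((a ≫ (h ^ 2 ^ n : End Y)) ≫
      α.dag (a ≫ (h ^ 2 ^ n : End Y)))).re := fun n => by
    simp only [f, dag_comp, (hN.norm_pow hh n).2]
    rw [pow_succ, pow_mul, sq, End.mul_def]
    simp only [Category.assoc]
  have fpos : ∀ n, 0 ≤ f n := fun n => by
    cases n with
    | zero => rw [f0]; exact φ.nonneg _
    | succ n => rw [fsucc]; exact φ.nonneg _
  have fsq : ∀ n, f n ^ 2 ≤ D * f (n + 1) := fun n => by
    rw [fsucc]; exact φ.re_sq_le a _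
  have fle : ∀ n, f n ≤ 64 * N X Y a ^ 2 * (N Y Z T ^ 2) ^ 2 ^ n := fun n => by
    refine (Complex.re_le_norm _).trans ((φ.norm_le _).trans ?_)
    have h1 := hN.norm_comp_dag_le a (a ≫ (h ^ 2 ^ n : End Y))
    have h2 := hN.norm_comp_end_le a (h ^ 2 ^ n : End Y)
    rw [(hN.norm_pow hh n).1, hN.cstar T] at h2
    have ha := apply_nonneg (N X Y) a
    calc _ ≤ _ := h1
      _ ≤ 4 * (N X Y a * (16 * (N X Y a * (N Y Z T ^ 2) ^ 2 ^ n))) := by gcongr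
      _ = _ := by ring
  rw [← f0]
  -- If `D = 0`, Cauchy–Schwarz already forces `f 0 = 0`; otherwise `f / D` satisfies the growth
  -- lemma.
  rcases hD0.eq_or_lt with h0 | h0
  · have := fsq 0
    rw [← h0, zero_mul] at this
    rw [← h0, mul_zero]
    nlinarith
  have := le_of_sq_le_succ (g := fun n => f n / D) (K := 64 * N X Y a ^ 2 / D)
    (R := N Y Z T ^ 2) (by positivity) (fun n => div_nonneg (fpos n) h0.le)
    (fun n => by
      rw [div_pow, div_le_div_iff₀ (by positivity) h0]
      have := mul_le_mul_of_nonneg_right (fsq n) h0.le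
      linarith)
    (fun n => by
      rw [div_mul_eq_mul_div]
      exact div_le_div_of_nonneg_right (fle n) h0.le)
  rwa [div_le_iff₀ h0] at this

end InvariantState

/-! ### The pre-Hilbert space of all invariant states -/

/-- The algebraic direct sum, over all invariant states `φ` of the algebras `End X`, of the spaces
`Hom(X, Y)` with the semi-inner products `φ(a† b)`. -/
def PreGNS (α : Involution C) (N : ∀ X Y : C, Seminorm ℂ (X ⟶ Y)) (Y : C) : Type (max u v) :=
  Π₀ i : (Σ X : C, α.InvariantState N X), (i.1 ⟶ Y)

namespace PreGNS

variable {α : Involution C} {N : ∀ X Y : C, Seminorm ℂ (X ⟶ Y)} {X Y Z W : C}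

instance : AddCommGroup (α.PreGNS N Y) :=
  inferInstanceAs (AddCommGroup (Π₀ i : (Σ X : C, α.InvariantState N X), (i.1 ⟶ Y)))

instance : Module ℂ (α.PreGNS N Y) :=
  inferInstanceAs (Module ℂ (Π₀ i : (Σ X : C, α.InvariantState N X), (i.1 ⟶ Y)))

/-- The component of a vector in `Hom(X, Y)`. -/
def comp (i : Σ X : C, α.InvariantState N X) : α.PreGNS N Y →ₗ[ℂ] (i.1 ⟶ Y) :=
  DFinsupp.lapply i

open Classical in
/-- The set of nonzero components. -/
def supp (a : α.PreGNS N Y) : Finset (Σ X : C, α.InvariantState N X) :=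
  DFinsupp.support (β := fun i : (Σ X : C, α.InvariantState N X) => (i.1 ⟶ Y)) a

theorem comp_eq_zero {a : α.PreGNS N Y} {i} (h : i ∉ supp a) : comp i a = 0 := by
  classical
  exact DFinsupp.notMem_support_iff.1 h

theorem ext_comp {a b : α.PreGNS N Y} (h : ∀ i, comp i a = comp i b) : a = b := DFinsupp.ext h

/-- The semi-inner product of the direct sum. -/
def form (a b : α.PreGNS N Y) : ℂ :=
  ∑ i ∈ supp a, i.2.toLin (comp i b ≫ α.dag (comp i a))

/-- Allows forms of vectors with different supports to be compared over a common index set. -/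
theorem form_eq_sum (a b : α.PreGNS N Y) {s : Finset (Σ X : C, α.InvariantState N X)}
    (hs : supp a ⊆ s) : form a b = ∑ i ∈ s, i.2.toLin (comp i b ≫ α.dag (comp i a)) :=
  Finset.sum_subset hs fun i _ hi => by
    have : α.dag (0 : i.1 ⟶ Y) = 0 := by simpa using α.dag_smul 0 (0 : i.1 ⟶ Y)
    rw [comp_eq_zero hi, this, Limits.comp_zero, map_zero]

theorem form_conj_symm (a b : α.PreGNS N Y) : starRingEnd ℂ (form b a) = form a b := by
  classical
  rw [form_eq_sum b a Finset.subset_union_right, form_eq_sum a b (Finset.subset_union_left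
    (s₂ := supp b)), map_sum]
  refine Finset.sum_congr rfl fun i _ => ?_
  rw [← i.2.dag_apply, dag_comp, dag_dag]

theorem form_self_re (a : α.PreGNS N Y) :
    (form a a).re = ∑ i ∈ supp a, (i.2.toLin (comp i a ≫ α.dag (comp i a))).re := by
  rw [form, Complex.re_sum]

/-- The semi-inner product space structure of the direct sum. -/
@[reducible] def core (α : Involution C) (N : ∀ X Y : C, Seminorm ℂ (X ⟶ Y)) (Y : C) :
    PreInnerProductSpace.Core ℂ (α.PreGNS N Y) where
  inner := form
  conj_inner_symm := form_conj_symm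
  re_inner_nonneg a := by
    change 0 ≤ (form a a).re
    rw [form_self_re]
    exact Finset.sum_nonneg fun i _ => i.2.nonneg _
  add_left a b c := by
    classical
    have h1 : supp a ⊆ supp a ∪ supp b ∪ supp (a + b) := by grind
    have h2 : supp b ⊆ supp a ∪ supp b ∪ supp (a + b) := by grind
    have h3 : supp (a + b) ⊆ supp a ∪ supp b ∪ supp (a + b) := by grind
    rw [form_eq_sum _ _ h1, form_eq_sum _ _ h2, form_eq_sum _ _ h3, ← Finset.sum_add_distrib]
    refine Finset.sum_congr rfl fun i _ => ?_
    rw [map_add, dag_add, Preadditive.comp_add, map_add]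
  smul_left a b c := by
    classical
    rw [form_eq_sum a _ Finset.subset_union_left, form_eq_sum (c • a) b
      (Finset.subset_union_right (s₁ := supp a)), Finset.mul_sum]
    refine Finset.sum_congr rfl fun i _ => ?_
    rw [map_smul, dag_smul, Linear.comp_smul, map_smul, smul_eq_mul]

instance : SeminormedAddCommGroup (α.PreGNS N Y) :=
  @InnerProductSpace.Core.toSeminormedAddCommGroup ℂ _ _ _ _ (core α N Y)

instance : InnerProductSpace ℂ (α.PreGNS N Y) := InnerProductSpace.ofCore (core α N Y)

theorem inner_eq_form (a b : α.PreGNS N Y) : inner ℂ a b = form a b := rfl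

theorem norm_sq_eq_sum (a : α.PreGNS N Y) {s : Finset (Σ X : C, α.InvariantState N X)}
    (hs : supp a ⊆ s) :
    ‖a‖ ^ 2 = ∑ i ∈ s, (i.2.toLin (comp i a ≫ α.dag (comp i a))).re := by
  rw [norm_sq_eq_re_inner (𝕜 := ℂ), inner_eq_form, form_eq_sum a a hs, ← Complex.re_sum]; rfl

/-- Composition with a morphism, as a linear map on the direct sums. -/
def postcompₗ (T : Y ⟶ Z) : α.PreGNS N Y →ₗ[ℂ] α.PreGNS N Z :=
  DFinsupp.mapRange.linearMap fun i : (Σ X : C, α.InvariantState N X) => Linear.rightComp ℂ i.1 T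

theorem norm_postcompₗ_le (hN : α.IsCStarNorm N) (T : Y ⟶ Z) (a : α.PreGNS N Y) :
    ‖postcompₗ T a‖ ≤ N Y Z T * ‖a‖ := by
  classical
  rw [← sq_le_sq₀ (norm_nonneg _) (mul_nonneg (apply_nonneg _ _) (norm_nonneg _)), mul_pow,
    norm_sq_eq_sum _ Finset.subset_union_left,
    norm_sq_eq_sum a (Finset.subset_union_right (s₁ := supp (postcompₗ T a))), Finset.mul_sum]
  exact Finset.sum_le_sum fun i _ => i.2.re_comp_le hN _ T

/-- Composition with a morphism, as a bounded operator on the direct sums. -/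
def postcomp (hN : α.IsCStarNorm N) (T : Y ⟶ Z) : α.PreGNS N Y →L[ℂ] α.PreGNS N Z :=
  (postcompₗ T).mkContinuous (N Y Z T) (norm_postcompₗ_le hN T)

theorem comp_postcomp (hN : α.IsCStarNorm N) (T : Y ⟶ Z) (a : α.PreGNS N Y) (i) :
    comp i (postcomp hN T a) = comp i a ≫ T := rfl

theorem inner_postcomp (hN : α.IsCStarNorm N) (T : Y ⟶ Z) (a : α.PreGNS N Y) (b : α.PreGNS N Z) :
    inner ℂ (postcomp hN T a) b = inner ℂ a (postcomp hN (α.dag T) b) := by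
  classical
  rw [inner_eq_form, inner_eq_form, form_eq_sum _ _ Finset.subset_union_left, form_eq_sum a _
    (Finset.subset_union_right (s₁ := supp (postcomp hN T a)))]
  refine Finset.sum_congr rfl fun i _ => ?_
  rw [comp_postcomp, comp_postcomp, dag_comp, Category.assoc]

/-- `α`, as a linear map on the direct sums. -/
def symmₗ (Y : C) : α.PreGNS N Y →ₗ[ℂ] α.PreGNS N Y :=
  DFinsupp.mapRange.linearMap fun _ : (Σ X : C, α.InvariantState N X) => α.map

theorem comp_symmₗ (a : α.PreGNS N Y) (i) : comp i (symmₗ Y a) = α.map (comp i a) := rfl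

theorem symmₗ_symmₗ (a : α.PreGNS N Y) : symmₗ Y (symmₗ Y a) = a :=
  ext_comp fun i => by rw [comp_symmₗ, comp_symmₗ, α.map_map]

/-- The `α`-invariance of the states enters here: `φ(b ≫ (α a)†) = φ(α b ≫ a†)`. -/
theorem inner_symmₗ (a b : α.PreGNS N Y) : inner ℂ (symmₗ Y a) b = inner ℂ a (symmₗ Y b) := by
  classical
  rw [inner_eq_form, inner_eq_form, form_eq_sum _ _ Finset.subset_union_left, form_eq_sum a _
    (Finset.subset_union_right (s₁ := supp (symmₗ Y a)))]
  refine Finset.sum_congr rfl fun i _ => ?_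
  rw [comp_symmₗ, comp_symmₗ, ← i.2.map_apply, α.map_comp, α.map_dag, α.map_map]

/-- `α`, as a bounded operator on the direct sums. -/
def symm (Y : C) : α.PreGNS N Y →L[ℂ] α.PreGNS N Y :=
  (symmₗ Y).mkContinuous 1 fun a => by
    -- A symmetric involution is isometric: `‖Ua‖² = Re ⟨a, U²a⟩ = ‖a‖²`.
    rw [one_mul, ← sq_le_sq₀ (norm_nonneg _) (norm_nonneg _), norm_sq_eq_re_inner (𝕜 := ℂ),
      norm_sq_eq_re_inner (𝕜 := ℂ), inner_symmₗ, symmₗ_symmₗ]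

/-- A morphism `X ⟶ Y` as a vector in the component of a state of `End X`. -/
def single (i : Σ X : C, α.InvariantState N X) (x : i.1 ⟶ Y) : α.PreGNS N Y :=
  open Classical in
  DFinsupp.single (β := fun i : (Σ X : C, α.InvariantState N X) => (i.1 ⟶ Y)) i x

theorem comp_single (i : Σ X : C, α.InvariantState N X) (x : i.1 ⟶ Y) :
    comp i (single i x) = x := by
  classical
  exact DFinsupp.single_eq_same

theorem supp_single (i : Σ X : C, α.InvariantState N X) (x : i.1 ⟶ Y) :
    supp (single i x) ⊆ {i} := by
  classical
  exact DFinsupp.support_single_subset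

theorem norm_sq_single (i : Σ X : C, α.InvariantState N X) (x : i.1 ⟶ Y) :
    ‖single i x‖ ^ 2 = (i.2.toLin (x ≫ α.dag x)).re := by
  rw [norm_sq_eq_sum _ (supp_single i x), Finset.sum_singleton, comp_single]

theorem postcomp_single (hN : α.IsCStarNorm N) (i : Σ X : C, α.InvariantState N X) (x : i.1 ⟶ Y)
    (T : Y ⟶ Z) : postcomp hN T (single i x) = single i (x ≫ T) := by
  classical
  exact DFinsupp.mapRange_single (f := fun i : (Σ X : C, α.InvariantState N X) =>
    Linear.rightComp ℂ i.1 T) (hf := fun _ => map_zero _)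

end PreGNS

/-! ### The universal representation on Hilbert spaces -/

/-- The Hilbert space of the universal representation. -/
def GNS (α : Involution C) (N : ∀ X Y : C, Seminorm ℂ (X ⟶ Y)) (Y : C) : Type (max u v) :=
  UniformSpace.Completion (α.PreGNS N Y)

namespace GNS

variable {α : Involution C} {N : ∀ X Y : C, Seminorm ℂ (X ⟶ Y)} {X Y Z W : C}

instance : NormedAddCommGroup (α.GNS N Y) :=
  inferInstanceAs (NormedAddCommGroup (UniformSpace.Completion (α.PreGNS N Y)))

instance : InnerProductSpace ℂ (α.GNS N Y) :=
  inferInstanceAs (InnerProductSpace ℂ (UniformSpace.Completion (α.PreGNS N Y)))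

instance : CompleteSpace (α.GNS N Y) :=
  inferInstanceAs (CompleteSpace (UniformSpace.Completion (α.PreGNS N Y)))

/-- The canonical map to the completion. -/
def of (a : α.PreGNS N Y) : α.GNS N Y := (a : UniformSpace.Completion (α.PreGNS N Y))

theorem of_add (a b : α.PreGNS N Y) : of (a + b) = of a + of b := UniformSpace.Completion.coe_add a b

theorem of_smul (c : ℂ) (a : α.PreGNS N Y) : of (c • a) = c • of a :=
  UniformSpace.Completion.coe_smul c a

theorem norm_of (a : α.PreGNS N Y) : ‖of a‖ = ‖a‖ := UniformSpace.Completion.norm_coe a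

theorem inner_of (a b : α.PreGNS N Y) : inner ℂ (of a) (of b) = inner ℂ a b :=
  UniformSpace.Completion.inner_coe a b

@[elab_as_elim]
theorem induction_on {p : α.GNS N Y → Prop} (x : α.GNS N Y) (hp : IsClosed {x | p x})
    (ih : ∀ a, p (of a)) : p x := UniformSpace.Completion.induction_on x hp ih

@[elab_as_elim]
theorem induction_on₂ {p : α.GNS N Y → α.GNS N Z → Prop} (x : α.GNS N Y) (y : α.GNS N Z)
    (hp : IsClosed {x : α.GNS N Y × α.GNS N Z | p x.1 x.2}) (ih : ∀ a b, p (of a) (of b)) :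
    p x y := UniformSpace.Completion.induction_on₂ x y hp ih

/-- The operator `U` of `α` on the Hilbert space of the universal representation. -/
def symm (α : Involution C) (N : ∀ X Y : C, Seminorm ℂ (X ⟶ Y)) (Y : C) :
    α.GNS N Y →L[ℂ] α.GNS N Y := (PreGNS.symm Y).completion

theorem symm_of (a : α.PreGNS N Y) : symm α N Y (of a) = of (PreGNS.symm Y a) :=
  ContinuousLinearMap.completion_apply_coe _ a

theorem symm_symm (x : α.GNS N Y) : symm α N Y (symm α N Y x) = x := by
  induction x using induction_on with
  | hp => exact isClosed_eq (by fun_prop) continuous_id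
  | ih a =>
    rw [symm_of, symm_of]
    exact congrArg of (PreGNS.symmₗ_symmₗ a)

theorem inner_symm (x y : α.GNS N Y) : inner ℂ (symm α N Y x) y = inner ℂ x (symm α N Y y) := by
  induction x, y using induction_on₂ with
  | hp => exact isClosed_eq (by fun_prop) (by fun_prop)
  | ih a b =>
    rw [symm_of, symm_of, inner_of, inner_of]
    exact PreGNS.inner_symmₗ a b

variable (hN : α.IsCStarNorm N)

/-- The universal representation. -/
def rep (T : Y ⟶ Z) : α.GNS N Y →L[ℂ] α.GNS N Z := (PreGNS.postcomp hN T).completion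

theorem rep_of (T : Y ⟶ Z) (a : α.PreGNS N Y) :
    rep hN T (of a) = of (PreGNS.postcomp hN T a) :=
  ContinuousLinearMap.completion_apply_coe _ a

theorem rep_id : rep hN (𝟙 Y) = ContinuousLinearMap.id ℂ _ := by
  ext x
  induction x using induction_on with
  | hp => exact isClosed_eq (by fun_prop) (by fun_prop)
  | ih a =>
    rw [rep_of]
    exact congrArg of (PreGNS.ext_comp fun i => Category.comp_id _)

theorem rep_comp (S : Y ⟶ Z) (T : Z ⟶ W) : rep hN (S ≫ T) = rep hN T ∘L rep hN S := by
  ext x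
  induction x using induction_on with
  | hp => exact isClosed_eq (by fun_prop) (by fun_prop)
  | ih a =>
    rw [ContinuousLinearMap.comp_apply, rep_of, rep_of, rep_of]
    exact congrArg of (PreGNS.ext_comp fun i => (Category.assoc _ _ _).symm)

theorem rep_add (S T : Y ⟶ Z) : rep hN (S + T) = rep hN S + rep hN T := by
  ext x
  induction x using induction_on with
  | hp => exact isClosed_eq (by fun_prop) (by fun_prop)
  | ih a =>
    rw [add_apply, rep_of, rep_of, rep_of, ← of_add]
    exact congrArg of (PreGNS.ext_comp fun i => Preadditive.comp_add _ _ _ _ _ _)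

theorem rep_smul (c : ℂ) (T : Y ⟶ Z) : rep hN (c • T) = c • rep hN T := by
  ext x
  induction x using induction_on with
  | hp => exact isClosed_eq (rep hN _).continuous ((rep hN T).continuous.const_smul c)
  | ih a =>
    rw [smul_apply, rep_of, rep_of, ← of_smul]
    exact congrArg of (PreGNS.ext_comp fun i => Linear.comp_smul _ _ _ _ _ _)

theorem inner_rep (T : Y ⟶ Z) (x : α.GNS N Y) (y : α.GNS N Z) :
    inner ℂ (rep hN T x) y = inner ℂ x (rep hN (α.dag T) y) := by
  induction x, y using induction_on₂ with
  | hp => exact isClosed_eq (by fun_prop) (by fun_prop)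
  | ih a b =>
    rw [rep_of, rep_of, inner_of, inner_of]
    exact PreGNS.inner_postcomp hN T a b

theorem rep_map (T : Y ⟶ Z) (x : α.GNS N Y) :
    rep hN (α.map T) x = symm α N Z (rep hN T (symm α N Y x)) := by
  induction x using induction_on with
  | hp => exact isClosed_eq (by fun_prop) (by fun_prop)
  | ih a =>
    rw [symm_of, rep_of, rep_of, symm_of]
    refine congrArg of (PreGNS.ext_comp fun i => ?_)
    change PreGNS.comp i a ≫ α.map T = α.map (α.map (PreGNS.comp i a) ≫ T)
    rw [α.map_comp, α.map_map]

theorem norm_rep_le (T : Y ⟶ Z) : ‖rep hN T‖ ≤ N Y Z T := by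
  refine ContinuousLinearMap.opNorm_le_bound _ (apply_nonneg _ _) fun x => ?_
  induction x using induction_on with
  | hp => exact isClosed_le (by fun_prop) (by fun_prop)
  | ih a =>
    rw [rep_of, norm_of, norm_of]
    exact PreGNS.norm_postcompₗ_le hN T a

/-- Test on the vector `𝟙 Y` in the summand of a state `φ` from `exists_state`: its norm is at most
1, and its image has squared norm `Re φ(T ≫ T†) ≥ N T ² / 2`. The constant 2 is a rounding of `√2`.
-/
theorem le_norm_rep (T : Y ⟶ Z) : N Y Z T ≤ 2 * ‖rep hN T‖ := by
  rcases eq_or_ne T 0 with rfl | h0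
  · rw [map_zero]; positivity
  obtain ⟨φ, hφ⟩ := hN.exists_state T h0
  let i : Σ X : C, α.InvariantState N X := ⟨Y, φ⟩
  let e : α.PreGNS N Y := PreGNS.single i (𝟙 Y)
  have h1 : ‖e‖ ^ 2 ≤ 1 := by
    rw [PreGNS.norm_sq_single, α.dag_id, Category.comp_id]
    exact (Complex.re_le_norm _).trans ((φ.norm_le _).trans (hN.norm_id_le Y))
  have h2 : ‖rep hN T (of e)‖ ^ 2 = (φ.toLin (T ≫ α.dag T)).re := by
    rw [rep_of, norm_of, PreGNS.postcomp_single, PreGNS.norm_sq_single,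
      Category.id_comp]
  have h3 := pow_le_pow_left₀ (norm_nonneg _) ((rep hN T).le_opNorm (of e)) 2
  rw [h2, mul_pow, norm_of] at h3
  have h4 : ‖rep hN T‖ ^ 2 * ‖e‖ ^ 2 ≤ ‖rep hN T‖ ^ 2 * 1 := by gcongr
  rw [← sq_le_sq₀ (apply_nonneg _ _) (by positivity)]
  nlinarith [sq_nonneg ‖rep hN T‖]

end GNS

end Involution

/-- A linear map that is bounded above and below for a Banach norm has closed range. -/
theorem IsBanachNorm.isClosed_range {V G : Type*} [AddCommGroup V] [Module ℂ V] {N : Seminorm ℂ V}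
    (hN : IsBanachNorm N) [NormedAddCommGroup G] [NormedSpace ℂ G] (f : V →ₗ[ℂ] G) {k l : ℝ}
    (hk : ∀ x, ‖f x‖ ≤ k * N x) (hl : ∀ x, N x ≤ l * ‖f x‖) : IsClosed (Set.range f) := by
  refine IsSeqClosed.isClosed fun s T hs hT => ?_
  choose x hx using hs
  -- The lower bound turns a convergent sequence of images into a Cauchy sequence of preimages.
  obtain ⟨y, hy⟩ := hN.complete x fun ε hε => by
    have h1 : Filter.Tendsto (fun p : ℕ × ℕ => l * ‖s p.1 - s p.2‖) Filter.atTop (nhds (l * 0)) :=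
      ((cauchySeq_iff_tendsto_dist_atTop_0.1 hT.cauchySeq).congr fun p =>
        dist_eq_norm _ _).const_mul l
    rw [mul_zero] at h1
    obtain ⟨⟨a, b⟩, hab⟩ := Filter.eventually_atTop.1 (h1.eventually (gt_mem_nhds hε))
    refine ⟨max a b, fun m hm n hn => ?_⟩
    have h2 := hab (m, n) ⟨(le_max_left a b).trans hm, (le_max_right a b).trans hn⟩
    have h3 := hl (x m - x n)
    rw [map_sub f, hx, hx] at h3
    exact h3.trans_lt h2
  have hy' := hy.const_mul k
  rw [mul_zero] at hy'
  refine ⟨y, tendsto_nhds_unique (tendsto_iff_norm_sub_tendsto_zero.2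
    (squeeze_zero (fun n => norm_nonneg _) (fun n => ?_) hy')) hT⟩
  rw [← hx, ← map_sub]
  exact hk _

/-! ### Kreĭn spaces from self-adjoint unitaries -/

namespace KreinSpace

section ofHilbert

variable {H : Type w} [NormedAddCommGroup H] [InnerProductSpace ℂ H]

/-- The Hermitian form `⟨x, U y⟩`. -/
def hilbertForm (U : H →L[ℂ] H) : H →ₗ⋆[ℂ] H →ₗ[ℂ] ℂ :=
  LinearMap.mk₂'ₛₗ (starRingEnd ℂ) (RingHom.id ℂ) (fun x y => inner ℂ x (U y))
    (fun x y z => inner_add_left x y (U z)) (fun c x y => inner_smul_left x (U y) c)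
    (fun x y z => by rw [map_add, inner_add_right])
    (fun c x y => by rw [map_smul, inner_smul_right]; rfl)

theorem hilbertForm_apply (U : H →L[ℂ] H) (x y : H) : hilbertForm U x y = inner ℂ x (U y) := rfl

theorem isHilbertOn_of_re_eq [CompleteSpace H] {B : H →ₗ⋆[ℂ] H →ₗ[ℂ] ℂ} {S : Submodule ℂ H}
    (hS : IsClosed (S : Set H)) (hB : ∀ x ∈ S, (B x x).re = ‖x‖ ^ 2) : IsHilbertOn B S where
  pos x hx h0 := by rw [hB x hx]; exact pow_pos (norm_pos_iff.2 h0) 2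
  complete s hs hc := by
    have hcs : CauchySeq s := Metric.cauchySeq_iff.2 fun ε hε => by
      obtain ⟨n₀, h₀⟩ := hc (ε ^ 2) (by positivity)
      refine ⟨n₀, fun m hm n hn => ?_⟩
      have := h₀ m hm n hn
      rw [hB _ (S.sub_mem (hs m) (hs n))] at this
      rw [dist_eq_norm]
      exact lt_of_pow_lt_pow_left₀ 2 hε.le this
    obtain ⟨x, hx⟩ := cauchySeq_tendsto_of_complete hcs
    have hxS : x ∈ S := hS.mem_of_tendsto hx (Filter.Eventually.of_forall hs)
    refine ⟨x, hxS, ?_⟩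
    have h1 := (tendsto_iff_norm_sub_tendsto_zero.1 hx).pow 2
    rw [zero_pow two_ne_zero] at h1
    exact h1.congr fun n => (hB _ (S.sub_mem (hs n) hxS)).symm

variable [CompleteSpace H] {U : H →L[ℂ] H}

/-- The summands are the eigenspaces of `U` for 1 and -1, closed and mutually orthogonal, on which
the form is `‖x‖²` and `-‖x‖²`. -/
theorem isFundamentalDecomposition_hilbertForm (hU : ∀ x, U (U x) = x)
    (hs : ∀ x y, inner ℂ (U x) y = inner ℂ x (U y)) :
    IsFundamentalDecomposition (hilbertForm U) ((U - ContinuousLinearMap.id ℂ H).ker)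
      ((U + ContinuousLinearMap.id ℂ H).ker) := by
  have memP : ∀ x, x ∈ (U - ContinuousLinearMap.id ℂ H).ker ↔ U x = x := fun x => by
    simp [LinearMap.mem_ker, sub_eq_zero]
  have memM : ∀ x, x ∈ (U + ContinuousLinearMap.id ℂ H).ker ↔ U x = -x := fun x => by
    simp [LinearMap.mem_ker, add_eq_zero_iff_eq_neg]
  refine ⟨⟨Submodule.disjoint_def.2 fun x hx hx' => ?_, codisjoint_iff.2 ?_⟩, fun x hx y hy => ?_,
    ?_, ?_⟩
  · rw [memP] at hx
    rw [memM, hx] at hx'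
    have h2 : (2 : ℂ) • x = 0 := by rw [two_smul]; exact add_eq_zero_iff_eq_neg.2 hx'
    exact (smul_eq_zero.1 h2).resolve_left two_ne_zero
  · refine eq_top_iff.2 fun x _ => ?_
    refine Submodule.mem_sup.2 ⟨(1 / 2 : ℂ) • (x + U x), ?_, (1 / 2 : ℂ) • (x - U x), ?_, ?_⟩
    · rw [memP, map_smul, map_add, hU, add_comm]
    · rw [memM, map_smul, map_sub, hU, ← smul_neg, neg_sub]
    · module
  · rw [memP] at hx
    rw [memM] at hy
    have h1 := hs x y
    rw [hx, hy, inner_neg_right] at h1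
    rw [hilbertForm_apply, hy, inner_neg_right, self_eq_neg.1 h1, neg_zero]
  · refine isHilbertOn_of_re_eq (ContinuousLinearMap.isClosed_ker _) fun x hx => ?_
    rw [hilbertForm_apply, (memP x).1 hx, norm_sq_eq_re_inner (𝕜 := ℂ)]
    rfl
  · refine isHilbertOn_of_re_eq (ContinuousLinearMap.isClosed_ker _) fun x hx => ?_
    rw [LinearMap.neg_apply, LinearMap.neg_apply, hilbertForm_apply, (memM x).1 hx,
      inner_neg_right, neg_neg, norm_sq_eq_re_inner (𝕜 := ℂ)]
    rfl

/-- The Krein space of a Hilbert space with a self-adjoint unitary. -/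
def ofHilbert (U : H →L[ℂ] H) (hU : ∀ x, U (U x) = x)
    (hs : ∀ x y, inner ℂ (U x) y = inner ℂ x (U y)) : KreinSpace.{w} where
  carrier := H
  form := hilbertForm U
  form_symm x y := by
    rw [hilbertForm_apply, hilbertForm_apply, inner_conj_symm, hs]
  exists_decomposition := ⟨_, _, isFundamentalDecomposition_hilbertForm hU hs⟩

variable (hU : ∀ x, U (U x) = x) (hs : ∀ x y, inner ℂ (U x) y = inner ℂ x (U y))

/-- The self-adjoint unitary as a fundamental symmetry. -/
def ofHilbertSymm : (ofHilbert U hU hs).FundamentalSymmetry where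
  toLin := U.toLinearMap
  exists_decomposition := by
    have h := isFundamentalDecomposition_hilbertForm hU hs
    refine ⟨_, _, h, fun (x : H) hx (y : H) hy => ?_⟩
    change U x - x = 0 at hx
    change U y + y = 0 at hy
    change U (x + y) = x - y
    rw [map_add, sub_eq_zero.1 hx, eq_neg_of_add_eq_zero_left hy, sub_eq_add_neg]

/-- The norm of the fundamental symmetry `U` comes from `⟨x, U (U x)⟩ = ⟨x, x⟩`. Thus the strong
topology is the original Hilbert topology. -/
theorem norm_toAssoc_ofHilbertSymm (x : H) : ‖(ofHilbertSymm hU hs).toAssoc x‖ = ‖x‖ := by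
  rw [← sq_eq_sq₀ (norm_nonneg _) (norm_nonneg _)]
  refine (FundamentalSymmetry.norm_sq_toAssoc _ _).trans ?_
  change (inner ℂ x (U (U x))).re = ‖x‖ ^ 2
  rw [hU, norm_sq_eq_re_inner (𝕜 := ℂ)]
  rfl

/-- The associated Hilbert space is the Hilbert space one started with. -/
def ofHilbertAssoc : (ofHilbertSymm hU hs).Assoc ≃ₗᵢ[ℂ] H where
  toLinearEquiv := (ofHilbertSymm hU hs).toAssoc.symm.trans (LinearEquiv.refl ℂ H)
  norm_map' x := by
    obtain ⟨x, rfl⟩ := (ofHilbertSymm hU hs).toAssoc.surjective x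
    exact (norm_toAssoc_ofHilbertSymm hU hs x).symm

/-- The identity map, from the Krein space with its strong topology to the Hilbert space. -/
def ofHilbertEquiv : ofHilbert U hU hs ≃L[ℂ] H :=
  (ofHilbertSymm hU hs).toAssocL.trans (ofHilbertAssoc hU hs).toContinuousLinearEquiv

end ofHilbert

end KreinSpace

/-! ### The universal representation on Kreĭn spaces and its image -/

namespace Involution

variable {C : Type u} [Category.{v} C] [Preadditive C] [Linear ℂ C] [StarCategory C]
  {α : Involution C} {N : ∀ X Y : C, Seminorm ℂ (X ⟶ Y)}

/-- The Krein spaces of the universal representation. -/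
def kreinGNS (α : Involution C) (N : ∀ X Y : C, Seminorm ℂ (X ⟶ Y)) (A : C) :
    KreinSpace.{max u v} :=
  KreinSpace.ofHilbert (GNS.symm α N A) GNS.symm_symm GNS.inner_symm

/-- The fundamental symmetries of the universal representation. -/
def kreinSymm (α : Involution C) (N : ∀ X Y : C, Seminorm ℂ (X ⟶ Y)) (A : C) :
    (α.kreinGNS N A).FundamentalSymmetry :=
  KreinSpace.ofHilbertSymm GNS.symm_symm GNS.inner_symm

/-- The identity map, from the Krein space to the Hilbert space. -/
def kreinEquiv (α : Involution C) (N : ∀ X Y : C, Seminorm ℂ (X ⟶ Y)) (A : C) :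
    α.kreinGNS N A ≃L[ℂ] α.GNS N A :=
  KreinSpace.ofHilbertEquiv GNS.symm_symm GNS.inner_symm

theorem form_kreinGNS {A : C} (x y : α.kreinGNS N A) : (α.kreinGNS N A).form x y =
    inner ℂ (α.kreinEquiv N A x) (GNS.symm α N A (α.kreinEquiv N A y)) := rfl

theorem kreinEquiv_symm_apply {A : C} (x : α.kreinGNS N A) :
    α.kreinEquiv N A (α.kreinSymm N A x) = GNS.symm α N A (α.kreinEquiv N A x) := rfl

namespace IsCStarNorm

variable (hN : α.IsCStarNorm N) {A B : C}

/-- The operators of the universal representation, between the Hilbert spaces. -/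
def repₗ (A B : C) : (A ⟶ B) →ₗ[ℂ] (α.GNS N A →L[ℂ] α.GNS N B) where
  toFun := GNS.rep hN
  map_add' := GNS.rep_add hN
  map_smul' := GNS.rep_smul hN

/-- The operators of the universal representation, between the Krein spaces. -/
def kreinRepₗ (A B : C) : (A ⟶ B) →ₗ[ℂ] (α.kreinGNS N A →L[ℂ] α.kreinGNS N B) :=
  ((α.kreinEquiv N A).symm.arrowCongr (α.kreinEquiv N B).symm).toLinearEquiv.toLinearMap ∘ₗ
    hN.repₗ A B

theorem kreinEquiv_kreinRepₗ (T : A ⟶ B) (x : α.kreinGNS N A) :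
    α.kreinEquiv N B (hN.kreinRepₗ A B T x) = GNS.rep hN T (α.kreinEquiv N A x) :=
  (α.kreinEquiv N B).apply_symm_apply _

theorem kreinRepₗ_id (A : C) : hN.kreinRepₗ A A (𝟙 A) = ContinuousLinearMap.id ℂ _ := by
  ext x
  apply (α.kreinEquiv N A).injective
  rw [kreinEquiv_kreinRepₗ, GNS.rep_id]
  rfl

theorem kreinRepₗ_comp {D : C} (S : A ⟶ B) (T : B ⟶ D) :
    hN.kreinRepₗ A D (S ≫ T) = hN.kreinRepₗ B D T ∘L hN.kreinRepₗ A B S := by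
  ext x
  apply (α.kreinEquiv N D).injective
  rw [kreinEquiv_kreinRepₗ, GNS.rep_comp, ContinuousLinearMap.comp_apply,
    ContinuousLinearMap.comp_apply, kreinEquiv_kreinRepₗ, kreinEquiv_kreinRepₗ]

theorem kreinRepₗ_map (T : A ⟶ B) : hN.kreinRepₗ A B (α.map T) =
    (α.kreinSymm N B).toCLM ∘L hN.kreinRepₗ A B T ∘L (α.kreinSymm N A).toCLM := by
  ext x
  apply (α.kreinEquiv N B).injective
  rw [kreinEquiv_kreinRepₗ, GNS.rep_map, ContinuousLinearMap.comp_apply]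
  refine Eq.trans ?_ (kreinEquiv_symm_apply _).symm
  rw [ContinuousLinearMap.comp_apply, kreinEquiv_kreinRepₗ]
  rfl

/-- The Hilbert adjoint of `π(T)` is `π(T†) = π(α(T*)) = U π(T*) U`, so `⟨π(T) x, U y⟩ = ⟨x, U π(T*)
y⟩`. -/
theorem kreinRepₗ_star (T : A ⟶ B) :
    hN.kreinRepₗ B A (star T) = KreinSpace.adjoint (hN.kreinRepₗ A B T) := by
  refine (KreinSpace.eq_adjoint fun x y => ?_).symm
  rw [form_kreinGNS, form_kreinGNS, kreinEquiv_kreinRepₗ, kreinEquiv_kreinRepₗ, GNS.inner_rep,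
    dag, GNS.rep_map, GNS.symm_symm]

theorem kreinRepₗ_injective (A B : C) : Function.Injective (hN.kreinRepₗ A B) := by
  refine ((α.kreinEquiv N A).symm.arrowCongr (α.kreinEquiv N B).symm).injective.comp
    ((injective_iff_map_eq_zero (hN.repₗ A B)).2 fun T hT => ?_)
  have h1 := GNS.le_norm_rep hN T
  have h2 : ‖GNS.rep hN T‖ = 0 := norm_eq_zero.2 hT
  rw [h2, mul_zero] at h1
  exact (hN.banach A B).eq_zero T (le_antisymm h1 (apply_nonneg _ _))

theorem isClosed_range_repₗ (A B : C) : IsClosed (Set.range (hN.repₗ A B)) := by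
  exact (hN.banach A B).isClosed_range (hN.repₗ A B) (k := 1)
    (fun T => (GNS.norm_rep_le hN T).trans_eq (one_mul _).symm) (GNS.le_norm_rep hN)

/-- Conjugation by the identity maps between Kreĭn and Hilbert spaces is a homeomorphism of the
operator spaces, so closedness is inherited from the Hilbert picture. -/
theorem isClosed_range_kreinRepₗ (A B : C) : IsClosed (Set.range (hN.kreinRepₗ A B)) := by
  have h := ((α.kreinEquiv N A).symm.arrowCongr (α.kreinEquiv N B).symm).toHomeomorph.isClosedMap
    _ (hN.isClosed_range_repₗ A B)
  rwa [← Set.range_comp] at h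

/-- The universal representation, as a functor. -/
def functor : C ⥤ BK (α.kreinGNS N) where
  obj A := ⟨A⟩
  map {A B} T := hN.kreinRepₗ A B T
  map_id := hN.kreinRepₗ_id
  map_comp := hN.kreinRepₗ_comp

/-- The image of the universal representation. -/
def image : StarSubcategory (BK (α.kreinGNS N)) where
  hom X Y := LinearMap.range (hN.kreinRepₗ X.idx Y.idx)
  id_mem X := ⟨𝟙 X.idx, hN.kreinRepₗ_id X.idx⟩
  comp_mem := by
    rintro X Y Z _ _ ⟨S, rfl⟩ ⟨T, rfl⟩
    exact ⟨S ≫ T, hN.kreinRepₗ_comp S T⟩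
  star_mem := by
    rintro X Y _ ⟨T, rfl⟩
    exact ⟨star T, hN.kreinRepₗ_star T⟩

/-- The universal representation, as a functor onto its image. -/
def toImage : C ⥤ hN.image.Obj where
  obj A := ⟨⟨A⟩⟩
  map {A B} T := ⟨hN.kreinRepₗ A B T, T, rfl⟩
  map_id A := Subtype.ext (hN.kreinRepₗ_id A)
  map_comp S T := Subtype.ext (hN.kreinRepₗ_comp S T)

/-- The isomorphism of a space of morphisms onto its image. -/
def homEquiv (X Y : hN.image.Obj) : (X.obj.idx ⟶ Y.obj.idx) ≃ₗ[ℂ] (X ⟶ Y) :=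
  LinearEquiv.ofInjective _ (hN.kreinRepₗ_injective X.obj.idx Y.obj.idx)

theorem isStarIso_toImage : IsStarIso hN.toImage where
  map_add x y := (hN.homEquiv ⟨⟨_⟩⟩ ⟨⟨_⟩⟩).map_add x y
  map_smul c x := (hN.homEquiv ⟨⟨_⟩⟩ ⟨⟨_⟩⟩).map_smul c x
  map_star x := Subtype.ext (hN.kreinRepₗ_star x)
  bijective_obj := ⟨fun _ _ h => congrArg (fun X => X.obj.idx) h, fun X => ⟨X.obj.idx, rfl⟩⟩
  bijective_map X Y := (hN.homEquiv ⟨⟨X⟩⟩ ⟨⟨Y⟩⟩).bijective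

theorem isStarFunctor_functor : IsStarFunctor hN.functor where
  map_add {X Y} x y := (hN.kreinRepₗ X Y).map_add x y
  map_smul {X Y} c x := (hN.kreinRepₗ X Y).map_smul c x
  map_star x := hN.kreinRepₗ_star x

/-- The restriction of `α_J` to the image of the universal representation. -/
def imageInvolution : Involution hN.image.Obj where
  map {X Y} :=
    { toFun := fun T => ⟨(BK.conj (α.kreinSymm N)).map T.1, by
        obtain ⟨_, T, rfl⟩ := T
        exact ⟨α.map T, hN.kreinRepₗ_map T⟩⟩
      map_add' := fun S T => Subtype.ext (map_add (BK.conj (α.kreinSymm N)).map S.1 T.1)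
      map_smul' := fun c T => Subtype.ext (map_smul (BK.conj (α.kreinSymm N)).map c T.1) }
  map_id X := Subtype.ext ((BK.conj (α.kreinSymm N)).map_id X.obj)
  map_comp S T := Subtype.ext ((BK.conj (α.kreinSymm N)).map_comp S.1 T.1)
  map_star T := Subtype.ext ((BK.conj (α.kreinSymm N)).map_star T.1)
  map_map T := Subtype.ext ((BK.conj (α.kreinSymm N)).map_map T.1)

theorem homEquiv_comp {X Y Z : hN.image.Obj} (x : X.obj.idx ⟶ Y.obj.idx)
    (y : Y.obj.idx ⟶ Z.obj.idx) :
    hN.homEquiv X Z (x ≫ y) = hN.homEquiv X Y x ≫ hN.homEquiv Y Z y :=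
  Subtype.ext (hN.kreinRepₗ_comp x y)

theorem homEquiv_dag {X Y : hN.image.Obj} (x : X.obj.idx ⟶ Y.obj.idx) :
    hN.homEquiv Y X (α.dag x) = hN.imageInvolution.dag (hN.homEquiv X Y x) :=
  Subtype.ext ((hN.kreinRepₗ_map (star x)).trans
    (congrArg (BK.conj (α.kreinSymm N)).map (hN.kreinRepₗ_star x)))

/-- The isomorphism of an endomorphism algebra onto its image. -/
def endHomEquiv (X : hN.image.Obj) : End X.obj.idx ≃ₐ[ℂ] End X :=
  AlgEquiv.ofLinearEquiv (hN.homEquiv X X) (Subtype.ext (hN.kreinRepₗ_id X.obj.idx))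
    fun x y => hN.homEquiv_comp y x

/-- The norms `N` and the spectra are transported along the isomorphism onto the image. The
definition allows any Banach norms, so `N` need not be compared with the operator norm here. -/
theorem isFundamentalSymmetry_imageInvolution :
    hN.imageInvolution.IsFundamentalSymmetry := by
  refine ⟨⟨fun X Y => (N X.obj.idx Y.obj.idx).comp (hN.homEquiv X Y).symm.toLinearMap,
    fun X Y => ⟨fun T hT => ?_, fun s hs => ?_⟩, fun {X Y} T => ?_⟩, fun {X Y} T => ?_⟩
  · exact (hN.homEquiv X Y).symm.map_eq_zero_iff.1 ((hN.banach _ _).eq_zero _ hT)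
  · obtain ⟨x, hx⟩ := (hN.banach _ _).complete (fun n => (hN.homEquiv X Y).symm (s n))
      fun ε hε => by simpa only [Seminorm.comp_apply, LinearEquiv.coe_coe, map_sub] using hs ε hε
    refine ⟨hN.homEquiv X Y x, ?_⟩
    simpa only [Seminorm.comp_apply, LinearEquiv.coe_coe, map_sub,
      LinearEquiv.symm_apply_apply] using hx
  · obtain ⟨x, rfl⟩ := (hN.homEquiv X Y).surjective T
    change (N _ _).comp _ (_ ≫ hN.imageInvolution.dag _) = _
    rw [← homEquiv_dag, ← homEquiv_comp, Seminorm.comp_apply, Seminorm.comp_apply,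
      LinearEquiv.coe_coe, LinearEquiv.coe_coe, LinearEquiv.symm_apply_apply,
      LinearEquiv.symm_apply_apply, hN.cstar]
  · obtain ⟨x, rfl⟩ := (hN.homEquiv X Y).surjective T
    change hN.imageInvolution.IsPositive (_ ≫ hN.imageInvolution.dag _)
    refine ⟨hN.imageInvolution.dag_comp_dag_self _, ?_⟩
    rw [← homEquiv_dag, ← homEquiv_comp]
    have h := (hN.pos x).2
    rwa [← AlgEquiv.spectrum_eq (hN.endHomEquiv X)] at h

end IsCStarNorm

end Involution

end Krein
end

open Krein in
theorem mainTheorem2 {C : Type u} [Category.{v} C] [Preadditive C] [Linear ℂ C]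
    [StarCategory C] (α : Involution C) (hα : α.IsFundamentalSymmetry) :
    ∃ (K : C → KreinSpace.{max u v}) (J : ∀ A, (K A).FundamentalSymmetry) (π : C ⥤ BK K),
      IsStarFunctor π ∧ (∀ A, π.obj A = ⟨A⟩) ∧ π.Faithful ∧
      (∀ {A B : C} (x : A ⟶ B), π.map (α.map x) = (BK.conj J).map (π.map x)) ∧
      ∃ S : StarSubcategory (BK K), BK.IsClosedSubcategory S ∧
        IsKreinCStarCategory S.Obj ∧
        (∃ β : Involution S.Obj, β.IsFundamentalSymmetry ∧
          ∀ {X Y : S.Obj} (T : X ⟶ Y), (β.map T).1 = (BK.conj J).map T.1) ∧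
        ∃ F : C ⥤ S.Obj, IsStarIso F ∧ F ⋙ S.incl = π := by
  obtain ⟨N, hN⟩ := hα.exists_norm
  have hβ := hN.isFundamentalSymmetry_imageInvolution
  exact ⟨α.kreinGNS N, α.kreinSymm N, hN.functor, hN.isStarFunctor_functor, fun _ => rfl,
    ⟨fun {A B} _ _ h => hN.kreinRepₗ_injective A B h⟩, fun x => hN.kreinRepₗ_map x, hN.image,
    fun X Y => hN.isClosed_range_kreinRepₗ X.idx Y.idx, ⟨_, hβ⟩, ⟨_, hβ, fun _ => rfl⟩,
    hN.toImage, hN.isStarIso_toImage, rfl⟩
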